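/- Let $n\ge 1$, let $G$ be a compact Lie group and let $M$ be a smooth $n$-manifold (Hausdorff, second countable, without boundary) with a smooth $G$-action. Let $p\in M$ be a fixed point whose isotropy representation is $\rho:G\to O(n)$; that is, there is a linear isomorphism $L:\mathbb R^n\to T_pM$ with $d(g\,\cdot)_p\circ L=L\circ\rho(g)$ for all $g\in G$. Let $\varphi:S^{n-1}\to G$ be a smooth map with $$\varphi(\rho(g)x)=g\,\varphi(x)\,g^{-1}\qquad (g\in G,\ x\in S^{n-1}).$$ Let $\widehat\varphi:S^{n-1}\to S^{n-1}$, $\widehat\varphi(x)=\rho(\varphi(x))x$; it is a diffeomorphism. Let $\Sigma^n=D^n\cup_{\widehat\varphi}D^n$ be the twisted sphere obtained from two closed unit discs by gluing each $x\in S^{n-1}$ in the boundary of the first to $\widehat\varphi(x)$ in the boundary of the second. (Its smooth structure is obtained from radial collars: $\Sigma^n=\mathbb R^n\cup\mathbb R^n$ with $r x$ in the first copy identified with $r^{-1}\widehat\varphi(x)$ in the second copy, for $r>0$, $x\in S^{n-1}$.) Then there is a special $G$-$G$-bundle $$M\xleftarrow{\ \pi\ }P\xrightarrow{\ \pi'\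 }M\#\Sigma^n .$$ Here $M\#\Sigma^n$ is the connected sum formed at $p$ along any smooth disc $i:\mathbb R^n\to M$ (a diffeomorphism onto an open subset) with $i(0)=p$ and $di_0=L$, and along the second disc $j:\mathbb R^n\to\Sigma^n$ of $\Sigma^n$: it is the (Hausdorff, second countable) smooth manifold obtained from $M\setminus\{i(0)\}$ and $\Sigma^n\setminus\{j(0)\}$ by identifying $i(v)$ with $j(v/|v|^2)$ for all $v\ne0$. A special $G$-$G$-bundle $M\xleftarrow{\pi}P\xrightarrow{\pi'}M'$ consists of a smooth manifold $P$ with a smooth action of $G\times G$ such that: (a) $\pi$ is a smooth principal $G$-bundle for the action of $\{1\}\times G$; (b) the action of $G\times\{1\}$ (the $\star$-action) is free and $\pi'$ is its quotient map, more precisely $\pi'$ is a smooth principal $G$-bundle for this action; (c) $\pi((r,1)q)=r\cdot\pi(q)$ for all $r\in G$, $q\in P$; (d) for every $q\in P$ there is $g\in G$ such that the isotropy group of $q$ is $(G\times G)_q=\{(h,ghg^{-1})\mid h\in G_{\pi(q)}\}$. -/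

import Mathlib

open Set Topology TopologicalSpace Metric
open scoped Manifold ContDiff EuclideanSpace

universe u v

/-- Euclidean space of dimension `n`. -/
abbrev Euc (n : ℕ) : Type := EuclideanSpace ℝ (Fin n)

/-! ### Gluing two manifolds along a diffeomorphism between open subsets -/

section Glue

variable {n : ℕ} {X : Type u} [TopologicalSpace X] [ChartedSpace (Euc n) X]
  {Y : Type v} [TopologicalSpace Y] [ChartedSpace (Euc n) Y]

/-- The relation on `X ⊔ Y` whose non-trivial relations are `x ∼ h x` for `x` in the
source of `h`. -/
def GlueRel (h : PartialDiffeomorph (𝓡 n) (𝓡 n) X Y ∞) : X ⊕ Y → X ⊕ Y → Prop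
  | .inl x, .inl x' => x = x'
  | .inl x, .inr y => x ∈ h.source ∧ h x = y
  | .inr y, .inl x => x ∈ h.source ∧ h x = y
  | .inr y, .inr y' => y = y'

theorem glueRel_equivalence (h : PartialDiffeomorph (𝓡 n) (𝓡 n) X Y ∞) :
    Equivalence (GlueRel h) where
  refl a := by cases a <;> simp [GlueRel]
  symm {a b} hab := by cases a <;> cases b <;> simp_all [GlueRel]
  trans {a b c} hab hbc := by
    rcases a with x | y <;> rcases b with x' | y' <;> rcases c with x'' | y'' <;>
      simp only [GlueRel] at hab hbc ⊢
    · exact hab.trans hbc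
    · exact hab ▸ hbc
    · exact h.injOn hab.1 hbc.1 (hab.2.trans hbc.2.symm)
    · exact ⟨hab.1, hab.2.trans hbc⟩
    · exact hbc ▸ hab
    · exact hab.2.symm.trans hbc.2
    · exact ⟨hbc.1, hbc.2.trans hab.symm⟩
    · exact hab.trans hbc

/-- The setoid of the gluing relation. -/
def glueSetoid (h : PartialDiffeomorph (𝓡 n) (𝓡 n) X Y ∞) : Setoid (X ⊕ Y) :=
  ⟨GlueRel h, glueRel_equivalence h⟩

/-- The space `X ∪_h Y` obtained from the disjoint union of `X` and `Y` by identifying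
`x` with `h x`, where `h` is a diffeomorphism from an open subset of `X` onto an open subset
of `Y`. It carries the quotient topology. -/
def Glue (h : PartialDiffeomorph (𝓡 n) (𝓡 n) X Y ∞) : Type (max u v) :=
  Quotient (glueSetoid h)

instance (h : PartialDiffeomorph (𝓡 n) (𝓡 n) X Y ∞) : TopologicalSpace (Glue h) :=
  inferInstanceAs (TopologicalSpace (Quotient (glueSetoid h)))

namespace Glue

variable (h : PartialDiffeomorph (𝓡 n) (𝓡 n) X Y ∞)

/-- The inclusion of the first piece. -/
def inl (x : X) : Glue h := Quotient.mk (glueSetoid h) (.inl x)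

/-- The inclusion of the second piece. -/
def inr (y : Y) : Glue h := Quotient.mk (glueSetoid h) (.inr y)

theorem inl_eq_inl {x x' : X} : inl h x = inl h x' ↔ x = x' :=
  Quotient.eq (r := glueSetoid h)

theorem inr_eq_inr {y y' : Y} : inr h y = inr h y' ↔ y = y' :=
  Quotient.eq (r := glueSetoid h)

theorem inl_eq_inr {x : X} {y : Y} : inl h x = inr h y ↔ x ∈ h.source ∧ h x = y :=
  Quotient.eq (r := glueSetoid h)

theorem exists_rep (q : Glue h) : (∃ x, inl h x = q) ∨ ∃ y, inr h y = q := by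
  induction q using Quotient.inductionOn with
  | h a => cases a with
    | inl x => exact .inl ⟨x, rfl⟩
    | inr y => exact .inr ⟨y, rfl⟩

theorem isOpen_iff {s : Set (Glue h)} :
    IsOpen s ↔ IsOpen (inl h ⁻¹' s) ∧ IsOpen (inr h ⁻¹' s) :=
  isOpen_coinduced.trans isOpen_sum_iff

theorem isOpenEmbedding_inl : IsOpenEmbedding (inl h) := by
  refine .of_continuous_injective_isOpenMap ?_ (fun x x' => (inl_eq_inl h).1) fun s hs => ?_
  · exact continuous_def.2 fun s hs => ((isOpen_iff h).1 hs).1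
  · refine (isOpen_iff h).2 ⟨?_, ?_⟩
    · rwa [preimage_image_eq _ fun x x' => (inl_eq_inl h).1]
    · convert! h.toOpenPartialHomeomorph.isOpen_image_source_inter hs using 1
      ext y
      simp only [mem_preimage, mem_image, inl_eq_inr, mem_inter_iff]
      exact ⟨fun ⟨x, hx, hxs, hxy⟩ => ⟨x, ⟨hxs, hx⟩, hxy⟩,
        fun ⟨x, ⟨hxs, hx⟩, hxy⟩ => ⟨x, hx, hxs, hxy⟩⟩

theorem isOpenEmbedding_inr : IsOpenEmbedding (inr h) := by
  refine .of_continuous_injective_isOpenMap ?_ (fun x x' => (inr_eq_inr h).1) fun s hs => ?_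
  · exact continuous_def.2 fun s hs => ((isOpen_iff h).1 hs).2
  · refine (isOpen_iff h).2 ⟨?_, ?_⟩
    · convert! h.toOpenPartialHomeomorph.isOpen_inter_preimage hs using 1
      ext x
      simp only [mem_preimage, mem_image, eq_comm (b := inl h x), inl_eq_inr, mem_inter_iff]
      exact ⟨fun ⟨y, hy, hx, hxy⟩ => ⟨hx, by rw [← hxy] at hy; exact hy⟩,
        fun ⟨hx, hxy⟩ => ⟨_, hxy, hx, rfl⟩⟩
    · rwa [preimage_image_eq _ fun y y' => (inr_eq_inr h).1]

open Classical in
/-- The smooth atlas of `X ∪_h Y`: the charts of `X` and the charts of `Y`. -/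
noncomputable instance : ChartedSpace (Euc n) (Glue h) where
  atlas := ((fun e => e.lift_openEmbedding (isOpenEmbedding_inl h)) '' atlas (Euc n) X) ∪
    ((fun e => e.lift_openEmbedding (isOpenEmbedding_inr h)) '' atlas (Euc n) Y)
  chartAt q := if hq : ∃ x, inl h x = q
    then (chartAt (Euc n) hq.choose).lift_openEmbedding (isOpenEmbedding_inl h)
    else (chartAt (Euc n) ((exists_rep h q).resolve_left hq).choose).lift_openEmbedding
      (isOpenEmbedding_inr h)
  mem_chart_source q := by
    split_ifs with hq
    · exact ⟨_, mem_chart_source _ _, hq.choose_spec⟩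
    · exact ⟨_, mem_chart_source _ _, ((exists_rep h q).resolve_left hq).choose_spec⟩
  chart_mem_atlas q := by
    split_ifs with hq
    · exact .inl ⟨_, chart_mem_atlas _ _, rfl⟩
    · exact .inr ⟨_, chart_mem_atlas _ _, rfl⟩

theorem contDiffOn_same {Z : Type*} [TopologicalSpace Z] [ChartedSpace (Euc n) Z]
    [IsManifold (𝓡 n) ∞ Z] {e f : OpenPartialHomeomorph Z (Euc n)}
    (he : e ∈ atlas (Euc n) Z) (hf : f ∈ atlas (Euc n) Z) :
    ContDiffOn ℝ ∞ (e.symm.trans f) (e.symm.trans f).source := by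
  rw [← contMDiffOn_iff_contDiffOn]
  have h1 := contMDiffOn_symm_of_mem_maximalAtlas (I := 𝓡 n) (n := ∞)
    (IsManifold.subset_maximalAtlas he)
  have h2 := contMDiffOn_of_mem_maximalAtlas (I := 𝓡 n) (n := ∞)
    (IsManifold.subset_maximalAtlas hf)
  exact h2.comp (h1.mono fun z hz => hz.1) fun z hz => hz.2

theorem contDiffOn_inl_inr [IsManifold (𝓡 n) ∞ X] [IsManifold (𝓡 n) ∞ Y]
    {e : OpenPartialHomeomorph X (Euc n)} (he : e ∈ atlas (Euc n) X)
    {f : OpenPartialHomeomorph Y (Euc n)} (hf : f ∈ atlas (Euc n) Y) :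
    ContDiffOn ℝ ∞
      (e.lift_openEmbedding (isOpenEmbedding_inl h) |>.symm.trans
        (f.lift_openEmbedding (isOpenEmbedding_inr h)))
      (e.lift_openEmbedding (isOpenEmbedding_inl h) |>.symm.trans
        (f.lift_openEmbedding (isOpenEmbedding_inr h))).source := by
  have key : ∀ z ∈ (e.lift_openEmbedding (isOpenEmbedding_inl h) |>.symm.trans
        (f.lift_openEmbedding (isOpenEmbedding_inr h))).source,
      z ∈ e.target ∧ e.symm z ∈ h.source ∧ h (e.symm z) ∈ f.source := by
    rintro z ⟨hz, y, hy, hyz⟩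
    have := (inl_eq_inr h).1 hyz.symm
    exact ⟨hz, this.1, (congrArg (· ∈ f.source) this.2).mpr hy⟩
  rw [← contMDiffOn_iff_contDiffOn]
  have h1 := contMDiffOn_symm_of_mem_maximalAtlas (I := 𝓡 n) (n := ∞)
    (IsManifold.subset_maximalAtlas he)
  have h2 := contMDiffOn_of_mem_maximalAtlas (I := 𝓡 n) (n := ∞)
    (IsManifold.subset_maximalAtlas hf)
  refine ContMDiffOn.congr (f := fun z => f (h (e.symm z))) ?_ ?_
  · exact h2.comp (h.contMDiffOn.comp (h1.mono fun z hz => (key z hz).1)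
      fun z hz => (key z hz).2.1) fun z hz => (key z hz).2.2
  · intro z hz
    have : inl h (e.symm z) = inr h (h (e.symm z)) := (inl_eq_inr h).2 ⟨(key z hz).2.1, rfl⟩
    change f.lift_openEmbedding (isOpenEmbedding_inr h) (inl h (e.symm z)) = _
    rw [this, OpenPartialHomeomorph.lift_openEmbedding_apply]

theorem contDiffOn_inr_inl [IsManifold (𝓡 n) ∞ X] [IsManifold (𝓡 n) ∞ Y]
    {e : OpenPartialHomeomorph X (Euc n)} (he : e ∈ atlas (Euc n) X)
    {f : OpenPartialHomeomorph Y (Euc n)} (hf : f ∈ atlas (Euc n) Y) :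
    ContDiffOn ℝ ∞
      (f.lift_openEmbedding (isOpenEmbedding_inr h) |>.symm.trans
        (e.lift_openEmbedding (isOpenEmbedding_inl h)))
      (f.lift_openEmbedding (isOpenEmbedding_inr h) |>.symm.trans
        (e.lift_openEmbedding (isOpenEmbedding_inl h))).source := by
  have key : ∀ z ∈ (f.lift_openEmbedding (isOpenEmbedding_inr h) |>.symm.trans
        (e.lift_openEmbedding (isOpenEmbedding_inl h))).source,
      z ∈ f.target ∧ f.symm z ∈ h.target ∧ h.symm (f.symm z) ∈ e.source := by
    rintro z ⟨hz, x, hx, hxz⟩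
    obtain ⟨hs, hxy⟩ := (inl_eq_inr h).1 hxz
    change h x = f.symm z at hxy
    refine ⟨hz, by rw [← hxy]; exact h.map_source hs, ?_⟩
    rw [← hxy]
    have : h.symm (h x) = x := h.left_inv hs
    rwa [this]
  rw [← contMDiffOn_iff_contDiffOn]
  have h1 := contMDiffOn_of_mem_maximalAtlas (I := 𝓡 n) (n := ∞)
    (IsManifold.subset_maximalAtlas he)
  have h2 := contMDiffOn_symm_of_mem_maximalAtlas (I := 𝓡 n) (n := ∞)
    (IsManifold.subset_maximalAtlas hf)
  refine ContMDiffOn.congr (f := fun z => e (h.symm (f.symm z))) ?_ ?_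
  · exact h1.comp (h.symm.contMDiffOn.comp (h2.mono fun z hz => (key z hz).1)
      fun z hz => (key z hz).2.1) fun z hz => (key z hz).2.2
  · intro z hz
    have : inl h (h.symm (f.symm z)) = inr h (f.symm z) :=
      (inl_eq_inr h).2 ⟨h.map_target (key z hz).2.1, h.right_inv (key z hz).2.1⟩
    change e.lift_openEmbedding (isOpenEmbedding_inl h) (inr h (f.symm z)) = _
    rw [← this, OpenPartialHomeomorph.lift_openEmbedding_apply]

instance [IsManifold (𝓡 n) ∞ X] [IsManifold (𝓡 n) ∞ Y] : IsManifold (𝓡 n) ∞ (Glue h) := by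
  refine isManifold_of_contDiffOn _ _ _ ?_
  rintro _ _ (⟨e, he, rfl⟩ | ⟨e, he, rfl⟩) (⟨f, hf, rfl⟩ | ⟨f, hf, rfl⟩)
  · simp only [OpenPartialHomeomorph.lift_openEmbedding_trans]
    simpa using contDiffOn_same he hf
  · simpa using contDiffOn_inl_inr h he hf
  · simpa using contDiffOn_inr_inl h hf he
  · simp only [OpenPartialHomeomorph.lift_openEmbedding_trans]
    simpa using contDiffOn_same he hf

/-- The inclusion of the second piece is a diffeomorphism onto an open subset. -/
noncomputable def inrDiffeo [IsManifold (𝓡 n) ∞ X] [IsManifold (𝓡 n) ∞ Y] [Nonempty Y] :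
    PartialDiffeomorph (𝓡 n) (𝓡 n) Y (Glue h) ∞ where
  toPartialEquiv := ((isOpenEmbedding_inr h).toOpenPartialHomeomorph (inr h)).toPartialEquiv
  open_source := isOpen_univ
  open_target := ((isOpenEmbedding_inr h).toOpenPartialHomeomorph (inr h)).open_target
  contMDiffOn_toFun := by
    intro y _
    refine ContMDiffAt.contMDiffWithinAt ?_
    have he := chart_mem_atlas (Euc n) y
    have hlift : (chartAt (Euc n) y).lift_openEmbedding (isOpenEmbedding_inr h) ∈
        IsManifold.maximalAtlas (𝓡 n) ∞ (Glue h) :=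
      IsManifold.subset_maximalAtlas (.inr ⟨_, he, rfl⟩)
    have h1 := contMDiffAt_symm_of_mem_maximalAtlas hlift
      (mem_chart_target (Euc n) y)
    refine (h1.comp y (contMDiffAt_of_mem_maximalAtlas
      (IsManifold.subset_maximalAtlas he) (mem_chart_source _ y))).congr_of_eventuallyEq ?_
    filter_upwards [(chartAt (Euc n) y).open_source.mem_nhds (mem_chart_source _ y)] with z hz
    exact congrArg (inr h) ((chartAt (Euc n) y).left_inv hz).symm
  contMDiffOn_invFun := by
    set r := (isOpenEmbedding_inr h).toOpenPartialHomeomorph (inr h)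
    have hr : ∀ z, r.symm (inr h z) = z := fun z => r.left_inv (mem_univ z)
    intro q hq
    refine ContMDiffAt.contMDiffWithinAt ?_
    obtain ⟨y, rfl⟩ : ∃ y, inr h y = q := ⟨r.symm q, r.right_inv hq⟩
    have he := chart_mem_atlas (Euc n) y
    set L := (chartAt (Euc n) y).lift_openEmbedding (isOpenEmbedding_inr h)
    have hlift : L ∈ IsManifold.maximalAtlas (𝓡 n) ∞ (Glue h) :=
      IsManifold.subset_maximalAtlas (.inr ⟨_, he, rfl⟩)
    have hy : inr h y ∈ L.source := ⟨y, mem_chart_source _ y, rfl⟩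
    have hL : ∀ z, L (inr h z) = chartAt (Euc n) y z := fun z =>
      OpenPartialHomeomorph.lift_openEmbedding_apply _ _
    have h1 := contMDiffAt_of_mem_maximalAtlas hlift hy
    refine ((contMDiffAt_symm_of_mem_maximalAtlas (IsManifold.subset_maximalAtlas he)
      (by rw [hL]; exact mem_chart_target (Euc n) y)).comp (inr h y) h1).congr_of_eventuallyEq ?_
    filter_upwards [L.open_source.mem_nhds hy]
    rintro _ ⟨z, hz, rfl⟩
    change r.symm (inr h z) = (chartAt (Euc n) y).symm (L (inr h z))
    rw [hr, hL, (chartAt (Euc n) y).left_inv hz]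

end Glue

end Glue

/-! ### Twisted spheres -/

section TwistedSphere

variable {m : ℕ}

/-- The unit sphere `S^m` of `ℝ^(m+1)`. -/
abbrev UnitSphere (m : ℕ) : Type := sphere (0 : Euc (m + 1)) 1

open Classical in
/-- The direction `x / |x|` of a non-zero vector (an arbitrary point of the sphere if `x = 0`). -/
noncomputable def direction (x : Euc (m + 1)) : UnitSphere m :=
  if hx : x = 0 then ⟨EuclideanSpace.single 0 1, by simp⟩
  else ⟨‖x‖⁻¹ • x, by simp [norm_smul, hx]⟩

theorem coe_direction {x : Euc (m + 1)} (hx : x ≠ 0) :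
    (direction x : Euc (m + 1)) = ‖x‖⁻¹ • x := by
  simp [direction, hx]

theorem direction_smul {t : ℝ} (ht : 0 < t) (x : UnitSphere m) :
    direction (t • (x : Euc (m + 1))) = x := by
  have h0 : (x : Euc (m + 1)) ≠ 0 := ne_zero_of_mem_unit_sphere x
  apply Subtype.ext
  rw [coe_direction (smul_ne_zero ht.ne' h0), norm_smul, smul_smul]
  simp [abs_of_pos ht, ht.ne']

theorem contMDiffOn_direction :
    ContMDiffOn (𝓡 (m + 1)) (𝓡 m) ∞ (direction (m := m)) {0}ᶜ := by
  intro x hx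
  refine ContMDiffAt.contMDiffWithinAt ?_
  let U : Opens (Euc (m + 1)) := ⟨{0}ᶜ, isOpen_compl_singleton⟩
  have h1 : ContMDiff (𝓡 (m + 1)) 𝓘(ℝ, Euc (m + 1)) ∞
      (fun y : U => (direction (y : Euc (m + 1)) : Euc (m + 1))) := by
    intro y
    refine (contMDiffAt_subtype_iff (U := U)
      (f := fun y => (direction y : Euc (m + 1))) (x := y)).2 ?_
    have hy : (y : Euc (m + 1)) ≠ 0 := y.2
    rw [contMDiffAt_iff_contDiffAt]
    refine (ContDiffAt.smul ((contDiffAt_norm ℝ hy).inv (norm_ne_zero_iff.2 hy))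
      contDiffAt_id).congr_of_eventuallyEq ?_
    filter_upwards [isOpen_compl_singleton.mem_nhds hy] with z hz
    exact coe_direction hz
  have h2 := h1.codRestrict_sphere (n := m) (fun y => (direction (y : Euc (m + 1))).2)
  exact (contMDiffAt_subtype_iff (U := U) (x := ⟨x, hx⟩)).1 (h2 ⟨x, hx⟩)

theorem contMDiffOn_radial {f : UnitSphere m → UnitSphere m}
    (hf : ContMDiff (𝓡 m) (𝓡 m) ∞ f) :
    ContMDiffOn (𝓡 (m + 1)) (𝓡 (m + 1)) ∞
      (fun x : Euc (m + 1) => ‖x‖⁻¹ • (f (direction x) : Euc (m + 1))) {0}ᶜ := by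
  have h1 : ContMDiffOn (𝓡 (m + 1)) 𝓘(ℝ, Euc (m + 1)) ∞
      (fun x => (f (direction x) : Euc (m + 1))) {0}ᶜ :=
    (contMDiff_coe_sphere (n := m)).comp_contMDiffOn (hf.comp_contMDiffOn contMDiffOn_direction)
  rw [contMDiffOn_iff_contDiffOn] at h1 ⊢
  have h2 : ContDiffOn ℝ ∞ (fun x : Euc (m + 1) => ‖x‖⁻¹) {0}ᶜ :=
    fun x (hx : x ≠ 0) => ((contDiffAt_norm ℝ hx).inv (norm_ne_zero_iff.2 hx)).contDiffWithinAt
  exact h2.smul h1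

/-- The diffeomorphism `r • x ↦ r⁻¹ • f x` (`r > 0`, `x` in the unit sphere) of `ℝ^(m+1) \ {0}`
induced by a diffeomorphism `f` of the unit sphere. -/
noncomputable def collarGluing (f : UnitSphere m ≃ₘ⟮𝓡 m, 𝓡 m⟯ UnitSphere m) :
    PartialDiffeomorph (𝓡 (m + 1)) (𝓡 (m + 1)) (Euc (m + 1)) (Euc (m + 1)) ∞ where
  toFun x := ‖x‖⁻¹ • (f (direction x) : Euc (m + 1))
  invFun y := ‖y‖⁻¹ • (f.symm (direction y) : Euc (m + 1))
  source := {0}ᶜ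
  target := {0}ᶜ
  map_source' x hx := smul_ne_zero (inv_ne_zero (norm_ne_zero_iff.2 hx))
    (ne_zero_of_mem_unit_sphere _)
  map_target' y hy := smul_ne_zero (inv_ne_zero (norm_ne_zero_iff.2 hy))
    (ne_zero_of_mem_unit_sphere _)
  left_inv' x hx := by
    have h0 : 0 < ‖x‖ := norm_pos_iff.2 hx
    rw [direction_smul (inv_pos.2 h0), f.symm_apply_apply, coe_direction hx, smul_smul]
    simp [norm_smul, h0.ne']
  right_inv' y hy := by
    have h0 : 0 < ‖y‖ := norm_pos_iff.2 hy
    rw [direction_smul (inv_pos.2 h0), f.apply_symm_apply, coe_direction hy, smul_smul]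
    simp [norm_smul, h0.ne']
  open_source := isOpen_compl_singleton
  open_target := isOpen_compl_singleton
  contMDiffOn_toFun := contMDiffOn_radial f.contMDiff
  contMDiffOn_invFun := contMDiffOn_radial f.symm.contMDiff

/-- The twisted sphere `D ∪_f D` of dimension `m + 1`: two closed unit discs glued along their
boundary spheres by the diffeomorphism `f : S^m → S^m`. To have a smooth structure, each disc `D`
is extended by the outer half of the collar `S^m × (-1, 1) → ℝ^(m+1)`,
`(x, t) ↦ (1 + t) / (1 - t) • x`, of its boundary, which turns it into `ℝ^(m+1)`, and `(x, t)` in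
the collar of the first disc is identified with `(f x, -t)` in the collar of the second one,
that is, `r • x` with `r⁻¹ • f x`. -/
abbrev TwistedSphere (f : UnitSphere m ≃ₘ⟮𝓡 m, 𝓡 m⟯ UnitSphere m) : Type :=
  Glue (collarGluing f)

end TwistedSphere

/-! ### Connected sums -/

section ConnectedSum

/-- A smooth disc in the `n`-manifold `M`: a diffeomorphism from `ℝ^n` onto an open subset of
`M`. -/
structure SmoothDisc (n : ℕ) (M : Type u) [TopologicalSpace M] [ChartedSpace (Euc n) M] extends
    PartialDiffeomorph (𝓡 n) (𝓡 n) (Euc n) M ∞ where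
  source_eq_univ : source = univ

/-- The second disc of the twisted sphere `D ∪_f D`. -/
noncomputable def TwistedSphere.secondDisc {m : ℕ}
    (f : UnitSphere m ≃ₘ⟮𝓡 m, 𝓡 m⟯ UnitSphere m) :
    SmoothDisc (m + 1) (TwistedSphere f) where
  toPartialDiffeomorph := Glue.inrDiffeo (collarGluing f)
  source_eq_univ := rfl

variable {m : ℕ} {M : Type u} [TopologicalSpace M] [ChartedSpace (Euc (m + 1)) M]
  {N : Type v} [TopologicalSpace N] [ChartedSpace (Euc (m + 1)) N]

/-- The open subset `M \ {i 0}`. -/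
def SmoothDisc.puncture (i : SmoothDisc (m + 1) M) : Opens M :=
  haveI : T1Space M := ChartedSpace.t1Space (Euc (m + 1)) M
  ⟨{i.toPartialDiffeomorph 0}ᶜ, isOpen_compl_singleton⟩

instance (i : SmoothDisc (m + 1) M) : Nonempty i.puncture := by
  refine ⟨i.toPartialDiffeomorph (EuclideanSpace.single 0 1), fun h => ?_⟩
  have := i.injOn (by simp [i.source_eq_univ]) (by simp [i.source_eq_univ]) h
  simp at this

/-- The inclusion of a non-empty open subset, as a diffeomorphism onto its image. -/
noncomputable def inclusionDiffeo (U : Opens M) [hU : Nonempty U] :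
    PartialDiffeomorph (𝓡 (m + 1)) (𝓡 (m + 1)) U M ∞ where
  toPartialEquiv := (U.openPartialHomeomorphSubtypeCoe hU).toPartialEquiv
  open_source := (U.openPartialHomeomorphSubtypeCoe hU).open_source
  open_target := (U.openPartialHomeomorphSubtypeCoe hU).open_target
  contMDiffOn_toFun := contMDiff_subtype_val.contMDiffOn
  contMDiffOn_invFun := by
    intro x hx
    refine (ContMDiffWithinAt.subtypeVal_comp_iff U _ _ x).1 ?_
    refine contMDiffWithinAt_id.congr (fun y hy => ?_) ?_
    · exact (U.openPartialHomeomorphSubtypeCoe hU).right_inv hy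
    · exact (U.openPartialHomeomorphSubtypeCoe hU).right_inv hx

/-- The gluing map of the connected sum: it sends `i v` to `j (v / |v|²)`, for `v ≠ 0`. -/
noncomputable def connectedSumGluing (i : SmoothDisc (m + 1) M) (j : SmoothDisc (m + 1) N) :
    PartialDiffeomorph (𝓡 (m + 1)) (𝓡 (m + 1)) i.puncture j.puncture ∞ :=
  (inclusionDiffeo i.puncture).trans <| i.toPartialDiffeomorph.symm.trans <|
    (collarGluing (Diffeomorph.refl (𝓡 m) (UnitSphere m) ∞)).trans <|
      j.toPartialDiffeomorph.trans (inclusionDiffeo j.puncture).symm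

/-- The connected sum `M # N` along the smooth discs `i` and `j`: the manifold obtained from
`M \ {i 0}` and `N \ {j 0}` by identifying `i v` with `j (v / |v|²)` for all `v ≠ 0`. -/
abbrev ConnectedSum (i : SmoothDisc (m + 1) M) (j : SmoothDisc (m + 1) N) : Type (max u v) :=
  Glue (connectedSumGluing i j)

end ConnectedSum

/-! ### The adjoint map of an equivariant map from the sphere to the group -/

section Adjoint

variable {m k : ℕ} {G : Type v} [Group G] [TopologicalSpace G] [ChartedSpace (Euc k) G]

/-- The restriction of a linear isometry to the unit sphere. -/
noncomputable def sphereIsometry (T : Euc (m + 1) ≃ₗᵢ[ℝ] Euc (m + 1)) (x : UnitSphere m) : UnitSphere m :=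
  ⟨T x, by simp⟩

theorem contMDiff_adjoint (ρ : G →* (Euc (m + 1) ≃ₗᵢ[ℝ] Euc (m + 1)))
    (hρ : ContMDiff ((𝓡 k).prod (𝓡 (m + 1))) (𝓡 (m + 1)) ∞
      fun z : G × Euc (m + 1) => ρ z.1 z.2)
    (φ : UnitSphere m → G) (hφ : ContMDiff (𝓡 m) (𝓡 k) ∞ φ) :
    ContMDiff (𝓡 m) (𝓡 m) ∞ fun x : UnitSphere m => sphereIsometry (ρ (φ x)) x :=
  ContMDiff.codRestrict_sphere (f := fun x : UnitSphere m => ρ (φ x) (x : Euc (m + 1)))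
    (hρ.comp (hφ.prodMk contMDiff_coe_sphere)) fun x => (sphereIsometry (ρ (φ x)) x).2

/-- The adjoint map `φ̂ : S^m → S^m`, `φ̂ x = ρ (φ x) x`, of a smooth map `φ : S^m → G` such that
`φ (ρ g x) = g (φ x) g⁻¹`. It is a diffeomorphism with inverse `y ↦ ρ (φ y)⁻¹ y`. -/
noncomputable def adjointDiffeo [LieGroup (𝓡 k) ∞ G] (ρ : G →* (Euc (m + 1) ≃ₗᵢ[ℝ] Euc (m + 1)))
    (hρ : ContMDiff ((𝓡 k).prod (𝓡 (m + 1))) (𝓡 (m + 1)) ∞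
      fun z : G × Euc (m + 1) => ρ z.1 z.2)
    (φ : UnitSphere m → G) (hφ : ContMDiff (𝓡 m) (𝓡 k) ∞ φ)
    (hconj : ∀ (g : G) (x : UnitSphere m), φ (sphereIsometry (ρ g) x) = g * φ x * g⁻¹) :
    UnitSphere m ≃ₘ⟮𝓡 m, 𝓡 m⟯ UnitSphere m where
  toFun x := sphereIsometry (ρ (φ x)) x
  invFun y := sphereIsometry (ρ (φ y)⁻¹) y
  left_inv x := by
    apply Subtype.ext
    change ρ (φ (sphereIsometry (ρ (φ x)) x))⁻¹ (ρ (φ x) x) = x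
    rw [hconj]
    simp
  right_inv y := by
    apply Subtype.ext
    change ρ (φ (sphereIsometry (ρ (φ y)⁻¹) y)) (ρ (φ y)⁻¹ y) = y
    rw [hconj]
    simp
  contMDiff_toFun := contMDiff_adjoint ρ hρ φ hφ
  contMDiff_invFun := by
    simpa using contMDiff_adjoint ρ hρ (fun y => (φ y)⁻¹) (hφ.inv (I := 𝓡 k))

end Adjoint

/-! ### `G`-`G`-bundles -/

section GGBundle

variable (n k : ℕ) (G : Type*) [Group G] [TopologicalSpace G] [ChartedSpace (Euc k) G]
  {P : Type*} [TopologicalSpace P] [ChartedSpace (ModelProd (Euc n) (Euc k)) P]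
  {M : Type*} [TopologicalSpace M] [ChartedSpace (Euc n) M]
  {M' : Type*} [TopologicalSpace M'] [ChartedSpace (Euc n) M']

/-- `π : P → M` is a smooth principal `G`-bundle for the action `act : G → P → P`: it is invariant,
and over a neighbourhood `U` of each point there is a trivialization, a diffeomorphism
`π⁻¹(U) → U × G` over `U` that turns the action of `s` into `(x, g) ↦ (x, s g)`. -/
structure IsPrincipalBundle (act : G → P → P) (π : P → M) : Prop where
  map_act : ∀ s q, π (act s q) = π q
  locally_trivial : ∀ x : M, ∃ U : Set M, IsOpen U ∧ x ∈ U ∧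
    ∃ Φ : PartialDiffeomorph ((𝓡 n).prod (𝓡 k)) ((𝓡 n).prod (𝓡 k)) P (M × G) ∞,
      Φ.source = π ⁻¹' U ∧ Φ.target = U ×ˢ univ ∧
      ∀ q ∈ π ⁻¹' U, (Φ q).1 = π q ∧ ∀ s, Φ (act s q) = (π q, s * (Φ q).2)

/-- `M ←π- P -π'→ M'` is a (special) `G`-`G`-bundle over the `G`-manifold `M`, with quotient `M'`:
`G × G` acts smoothly on `P`; the second factor is the principal action of the principal bundle
`π`; the first factor is the `⋆`-action, which covers the given action on `M` and is the
principal action of the principal bundle `π'` (so it is free with quotient `M'`); and each isotropy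
group `(G × G)_q` is `{(h, g h g⁻¹) | h ∈ G_{π q}}` for some `g`. -/
structure IsGGBundle [MulAction G M] [MulAction (G × G) P] (π : P → M) (π' : P → M') : Prop where
  smooth_action : ContMDiffSMul ((𝓡 k).prod (𝓡 k)) ((𝓡 n).prod (𝓡 k)) ∞ (G × G) P
  principal : IsPrincipalBundle n k G (fun (s : G) (q : P) => ((1, s) : G × G) • q) π
  star_quotient : IsPrincipalBundle n k G (fun (r : G) (q : P) => ((r, 1) : G × G) • q) π'
  equivariant : ∀ (r : G) (q : P), π (((r, 1) : G × G) • q) = r • π q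
  isotropy : ∀ q : P, ∃ g : G, (MulAction.stabilizer (G × G) q : Set (G × G)) =
    {a | ∃ h ∈ MulAction.stabilizer G (π q), a = (h, g * h * g⁻¹)}

end GGBundle

/-!
The connected sum with `Σ` along a disc `i` at `p` replaces this disc by the first disc of `Σ`: it
is `M \ {p}` together with a copy of `ℝ^n` in which `v ≠ 0` is identified with the point
`i (ρ(φ(v/|v|)) v)` of `M` (`firstDiscDiffeo_eq_inl`), because `v ↦ ρ(φ(v/|v|)) v` is the radial
extension of `φ̂`.

Suppose first that `i` is equivariant. On a trivial bundle `X × G` over a `G`-manifold `X`, let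
`G × G` act by `(r, s) (x, g) = (r x, s g r⁻¹)`. The projection `(x, g) ↦ x` is the quotient by the
second factor and `(x, g) ↦ g x` is the quotient by the first one; the involution
`(x, g) ↦ (g x, g⁻¹)` exchanges the two. Glue the trivial bundles over `ℝ^n` and over `M \ {p}` by
`(v, g) ↦ (i v, g φ(v/|v|))`. Since `φ(ρ(g) x) = g φ(x) g⁻¹`, this clutching map commutes with
`G × G`. It covers the identification `v ∼ i v` of the projections and the identification
`v ∼ i (ρ(φ(v/|v|)) v)` of the other quotients. Hence the two quotients of the glued bundle are `M`
and `M # Σ` (`IsBiequivariant.exists_isGGBundle`, `exists_isGGBundle_of_equivariantDisc`).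

An arbitrary disc `i` is reduced to an equivariant one by a diffeomorphism `Ψ` of `M`. Averaging a
function that inverts `i` near `p` over `G` gives an equivariant map `A : M → ℝ^n`, and `u = A ∘ i`
is smooth and tangent to the identity at `0`, because the derivative of `i` is a frame in which the
isotropy representation is `ρ` (`exists_equivariant_map`). The germ of `u` is realized by a
diffeomorphism `F` of `ℝ^n` with compact support: cut off `u - id` on a ball so small that the
perturbation of the identity has Lipschitz constant `1/2` (`exists_diffeomorph_eventuallyEq`).
Let `Ψ` be `i ∘ F ∘ i⁻¹` on the disc and the identity elsewhere. Then `Ψ⁻¹ ∘ i` is equivariant near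
`0` (`exists_diffeomorph_equivariant_near`); shrinking it radially makes it an equivariant disc. The
connected sum along `i` is recovered by embedding `M \ {p}` in it by means of `Ψ`.
-/

/-! ### Spaces covered by two open embeddings -/

section Cover

variable {X Y Q : Type*} [TopologicalSpace X] [TopologicalSpace Y] [TopologicalSpace Q]

theorem exists_separation_of_isOpenEmbedding [T2Space X] {a : X → Q} (ha : IsOpenEmbedding a)
    {x y : X} (hxy : a x ≠ a y) :
    ∃ u v : Set Q, IsOpen u ∧ IsOpen v ∧ a x ∈ u ∧ a y ∈ v ∧ Disjoint u v := by
  obtain ⟨u, v, hu, hv, hx, hy, huv⟩ := t2_separation (fun h => hxy (congrArg a h))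
  exact ⟨a '' u, a '' v, ha.isOpenMap _ hu, ha.isOpenMap _ hv, mem_image_of_mem _ hx,
    mem_image_of_mem _ hy, (disjoint_image_iff ha.injective).2 huv⟩

/-- A space covered by two Hausdorff open subspaces is Hausdorff as soon as the gluing relation
between them is closed. -/
theorem t2Space_of_isOpenEmbedding_cover [T2Space X] [T2Space Y] {a : X → Q} {b : Y → Q}
    (ha : IsOpenEmbedding a) (hb : IsOpenEmbedding b) (hab : ∀ q, q ∈ range a ∨ q ∈ range b)
    (hc : IsClosed {z : X × Y | a z.1 = b z.2}) : T2Space Q := by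
  have diff : ∀ x y, a x ≠ b y → ∃ u v : Set Q, IsOpen u ∧ IsOpen v ∧ a x ∈ u ∧ b y ∈ v ∧
      Disjoint u v := by
    intro x y hxy
    obtain ⟨u, v, hu, hv, hx, hy, huv⟩ := isOpen_prod_iff.1 hc.isOpen_compl x y hxy
    refine ⟨a '' u, b '' v, ha.isOpenMap _ hu, hb.isOpenMap _ hv, mem_image_of_mem _ hx,
      mem_image_of_mem _ hy, disjoint_left.2 ?_⟩
    rintro _ ⟨x', hx', rfl⟩ ⟨y', hy', h⟩
    exact huv (mk_mem_prod hx' hy') h.symm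
  refine ⟨fun q q' hne => ?_⟩
  rcases hab q with ⟨x, rfl⟩ | ⟨y, rfl⟩ <;> rcases hab q' with ⟨x', rfl⟩ | ⟨y', rfl⟩
  · exact exists_separation_of_isOpenEmbedding ha hne
  · exact diff x y' hne
  · obtain ⟨u, v, hu, hv, hx, hy, huv⟩ := diff x' y hne.symm
    exact ⟨v, u, hv, hu, hy, hx, huv.symm⟩
  · exact exists_separation_of_isOpenEmbedding hb hne

theorem secondCountable_of_isOpenEmbedding_cover [SecondCountableTopology X]
    [SecondCountableTopology Y] {a : X → Q} {b : Y → Q}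
    (ha : IsOpenEmbedding a) (hb : IsOpenEmbedding b) (hab : ∀ q, q ∈ range a ∨ q ∈ range b) :
    SecondCountableTopology Q := by
  have h1 : SecondCountableTopology (range a) :=
    ha.isEmbedding.toHomeomorph.symm.isInducing.secondCountableTopology
  have h2 : SecondCountableTopology (range b) :=
    hb.isEmbedding.toHomeomorph.symm.isInducing.secondCountableTopology
  have h3 : ∀ i : Bool, SecondCountableTopology (bif i then range a else range b : Set Q) := by
    rintro (_ | _)
    exacts [h2, h1]
  refine secondCountableTopology_of_countable_cover
    (U := fun i : Bool => bif i then range a else range b) ?_ ?_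
  · rintro (_ | _)
    exacts [hb.isOpen_range, ha.isOpen_range]
  · refine eq_univ_of_forall fun q => mem_iUnion.2 ?_
    exact (hab q).elim (fun h => ⟨true, h⟩) fun h => ⟨false, h⟩

end Cover

section ManifoldCover

variable {E H : Type*} [NormedAddCommGroup E] [NormedSpace ℝ E] [TopologicalSpace H]
  {I : ModelWithCorners ℝ E H}
  {X Y Q : Type*} [TopologicalSpace X] [ChartedSpace H X] [TopologicalSpace Y] [ChartedSpace H Y]
  [TopologicalSpace Q]

/-- Two charts of open pieces of `Q` are compatible if the transition between the pieces is
smooth. -/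
theorem contDiffOn_transition_of_isOpenEmbedding [Nonempty H] [IsManifold I ∞ X]
    [IsManifold I ∞ Y] {a : X → Q} {b : Y → Q}
    (ha : IsOpenEmbedding a) (hb : IsOpenEmbedding b) {t : X → Y}
    (ht : ContMDiffOn I I ∞ t {x | a x ∈ range b}) (hbt : ∀ x, a x ∈ range b → b (t x) = a x)
    {e : OpenPartialHomeomorph X H} (he : e ∈ atlas H X)
    {f : OpenPartialHomeomorph Y H} (hf : f ∈ atlas H Y) :
    ContDiffOn ℝ ∞
      (I ∘ (e.lift_openEmbedding ha).symm.trans (f.lift_openEmbedding hb) ∘ I.symm)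
      (I.symm ⁻¹' ((e.lift_openEmbedding ha).symm.trans (f.lift_openEmbedding hb)).source ∩
        range I) := by
  have key : ∀ z ∈ ((e.lift_openEmbedding ha).symm.trans (f.lift_openEmbedding hb)).source,
      z ∈ e.target ∧ a (e.symm z) ∈ range b ∧ t (e.symm z) ∈ f.source := by
    rintro z ⟨hz, y, hy, hyz⟩
    have h1 : a (e.symm z) ∈ range b := ⟨y, hyz⟩
    have h2 : t (e.symm z) = y := hb.injective ((hbt _ h1).trans hyz.symm)
    exact ⟨hz, h1, h2 ▸ hy⟩
  have h1 := contMDiffOn_symm_of_mem_maximalAtlas (I := I) (n := ∞)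
    (IsManifold.subset_maximalAtlas he)
  have h2 := contMDiffOn_of_mem_maximalAtlas (I := I) (n := ∞)
    (IsManifold.subset_maximalAtlas hf)
  have h3 : ContMDiffOn I I ∞ ((e.lift_openEmbedding ha).symm.trans (f.lift_openEmbedding hb))
      ((e.lift_openEmbedding ha).symm.trans (f.lift_openEmbedding hb)).source := by
    refine ContMDiffOn.congr (f := fun z => f (t (e.symm z))) ?_ ?_
    · exact h2.comp (ht.comp (h1.mono fun z hz => (key z hz).1) fun z hz => (key z hz).2.1)
        fun z hz => (key z hz).2.2
    · intro z hz
      change f.lift_openEmbedding hb (a (e.symm z)) = _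
      rw [← hbt _ (key z hz).2.1, OpenPartialHomeomorph.lift_openEmbedding_apply]
  rw [← contMDiffOn_iff_contDiffOn]
  exact I.contMDiff.comp_contMDiffOn (h3.comp
    (I.contMDiffOn_symm.mono inter_subset_right) fun z hz => hz.1)

variable [ChartedSpace H Q]

/-- An open embedding along which the charts of `X` are charts of `Q` is a diffeomorphism onto
its image. -/
noncomputable def diffeoOfIsOpenEmbedding [Nonempty H] [Nonempty X] [IsManifold I ∞ X]
    [IsManifold I ∞ Q]
    {a : X → Q} (ha : IsOpenEmbedding a)
    (hatlas : ∀ e ∈ atlas H X, e.lift_openEmbedding ha ∈ atlas H Q) :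
    PartialDiffeomorph I I X Q ∞ where
  toPartialEquiv := (ha.toOpenPartialHomeomorph a).toPartialEquiv
  open_source := isOpen_univ
  open_target := (ha.toOpenPartialHomeomorph a).open_target
  contMDiffOn_toFun := by
    intro x _
    refine ContMDiffAt.contMDiffWithinAt ?_
    have he := chart_mem_atlas H x
    have hlift := IsManifold.subset_maximalAtlas (I := I) (n := ∞) (hatlas _ he)
    have h1 := contMDiffAt_symm_of_mem_maximalAtlas hlift (mem_chart_target H x)
    refine (h1.comp x (contMDiffAt_of_mem_maximalAtlas
      (IsManifold.subset_maximalAtlas he) (mem_chart_source _ x))).congr_of_eventuallyEq ?_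
    filter_upwards [(chartAt H x).open_source.mem_nhds (mem_chart_source _ x)] with z hz
    exact congrArg a ((chartAt H x).left_inv hz).symm
  contMDiffOn_invFun := by
    set r := ha.toOpenPartialHomeomorph a
    have hr : ∀ z, r.symm (a z) = z := fun z => r.left_inv (mem_univ z)
    intro q hq
    refine ContMDiffAt.contMDiffWithinAt ?_
    obtain ⟨x, rfl⟩ : ∃ x, a x = q := ⟨r.symm q, r.right_inv hq⟩
    have he := chart_mem_atlas H x
    set L := (chartAt H x).lift_openEmbedding ha
    have hlift := IsManifold.subset_maximalAtlas (I := I) (n := ∞) (hatlas _ he)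
    have hx : a x ∈ L.source := ⟨x, mem_chart_source _ x, rfl⟩
    have hL : ∀ z, L (a z) = chartAt H x z := fun z =>
      OpenPartialHomeomorph.lift_openEmbedding_apply _ _
    have h1 := contMDiffAt_of_mem_maximalAtlas hlift hx
    refine ((contMDiffAt_symm_of_mem_maximalAtlas (IsManifold.subset_maximalAtlas he)
      (by rw [hL]; exact mem_chart_target H x)).comp (a x) h1).congr_of_eventuallyEq ?_
    filter_upwards [L.open_source.mem_nhds hx]
    rintro _ ⟨z, hz, rfl⟩
    change r.symm (a z) = (chartAt H x).symm (L (a z))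
    rw [hr, hL, (chartAt H x).left_inv hz]

end ManifoldCover

namespace PartialDiffeomorph

variable {E H : Type*} [NormedAddCommGroup E] [NormedSpace ℝ E] [TopologicalSpace H]
  {I : ModelWithCorners ℝ E H}
  {E' H' : Type*} [NormedAddCommGroup E'] [NormedSpace ℝ E'] [TopologicalSpace H']
  {I' : ModelWithCorners ℝ E' H'}
  {F K : Type*} [NormedAddCommGroup F] [NormedSpace ℝ F] [TopologicalSpace K]
  {J : ModelWithCorners ℝ F K}
  {F' K' : Type*} [NormedAddCommGroup F'] [NormedSpace ℝ F'] [TopologicalSpace K']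
  {J' : ModelWithCorners ℝ F' K'}
  {X Y Q : Type*} [TopologicalSpace X] [ChartedSpace H X] [TopologicalSpace Y] [ChartedSpace H Y]
  [TopologicalSpace Q] [ChartedSpace H Q]
  {X' Q' : Type*} [TopologicalSpace X'] [ChartedSpace H' X'] [TopologicalSpace Q']
  [ChartedSpace H' Q']
  {N : Type*} [TopologicalSpace N] [ChartedSpace K N]
  {S : Type*} [TopologicalSpace S] [ChartedSpace K' S]

/-- The product of two diffeomorphisms between open subsets. -/
def prodMap (a : PartialDiffeomorph I I X Q ∞) (b : PartialDiffeomorph I' I' X' Q' ∞) :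
    PartialDiffeomorph (I.prod I') (I.prod I') (X × X') (Q × Q') ∞ where
  toPartialEquiv := a.toPartialEquiv.prod b.toPartialEquiv
  open_source := a.open_source.prod b.open_source
  open_target := a.open_target.prod b.open_target
  contMDiffOn_toFun := a.contMDiffOn_toFun.prodMap b.contMDiffOn_toFun
  contMDiffOn_invFun := a.contMDiffOn_invFun.prodMap b.contMDiffOn_invFun

theorem left_inv_of_source_univ {a : PartialDiffeomorph I I X Q ∞} (ha : a.source = univ) (x : X) :
    a.symm (a x) = x :=
  a.left_inv (by simp [ha])

theorem target_eq_range {a : PartialDiffeomorph I I X Q ∞} (ha : a.source = univ) :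
    a.target = range a := by
  rw [← image_univ, ← ha]
  exact a.image_source_eq_target.symm

theorem contMDiff_of_source_univ {a : PartialDiffeomorph I I X Q ∞} (ha : a.source = univ) :
    ContMDiff I I ∞ a := by
  rw [← contMDiffOn_univ, ← ha]
  exact a.contMDiffOn

theorem isOpenEmbedding_of_source_univ {a : PartialDiffeomorph I I X Q ∞} (ha : a.source = univ) :
    IsOpenEmbedding a :=
  a.toOpenPartialHomeomorph.isOpenEmbedding ha

theorem contMDiffAt_of_comp {a : PartialDiffeomorph I I X Q ∞} {f : S × Q → N}
    (hf : ContMDiff (J'.prod I) J ∞ fun z : S × X => f (z.1, a z.2)) (s : S) {q : Q}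
    (hq : q ∈ a.target) : ContMDiffAt (J'.prod I) J ∞ f (s, q) := by
  have h1 : ContMDiffAt (J'.prod I) I ∞ (fun z : S × Q => a.symm z.2) (s, q) :=
    (a.symm.contMDiffOn.contMDiffAt (a.open_target.mem_nhds hq)).comp (s, q) contMDiffAt_snd
  refine (hf.contMDiffAt.comp (s, q) (contMDiffAt_fst.prodMk h1)).congr_of_eventuallyEq ?_
  filter_upwards [(a.open_target.preimage continuous_snd).mem_nhds hq] with z hz
  exact congrArg f (Prod.ext rfl (a.right_inv hz).symm)

/-- A map on `S × Q`, where `Q` is covered by open copies of `X` and `Y`, is smooth if its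
restrictions to `S × X` and `S × Y` are smooth. -/
theorem contMDiff_of_cover {a : PartialDiffeomorph I I X Q ∞} {b : PartialDiffeomorph I I Y Q ∞}
    (hab : ∀ q, q ∈ a.target ∨ q ∈ b.target) {f : S × Q → N}
    (hfa : ContMDiff (J'.prod I) J ∞ fun z : S × X => f (z.1, a z.2))
    (hfb : ContMDiff (J'.prod I) J ∞ fun z : S × Y => f (z.1, b z.2)) :
    ContMDiff (J'.prod I) J ∞ f := fun z =>
  (hab z.2).elim (contMDiffAt_of_comp hfa z.1) (contMDiffAt_of_comp hfb z.1)

end PartialDiffeomorph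

/-! ### Gluing manifolds with an arbitrary model -/

section ModelGlue

variable {E H : Type*} [NormedAddCommGroup E] [NormedSpace ℝ E] [TopologicalSpace H]
  {I : ModelWithCorners ℝ E H}
  {X : Type u} [TopologicalSpace X] [ChartedSpace H X]
  {Y : Type v} [TopologicalSpace Y] [ChartedSpace H Y]

/-- The equivalence relation on `X ⊔ Y` generated by `x ∼ h x` for `x` in the source of `h`. -/
def modelGlueSetoid (h : PartialDiffeomorph I I X Y ∞) : Setoid (X ⊕ Y) where
  r
    | .inl x, .inl x' => x = x'
    | .inl x, .inr y => x ∈ h.source ∧ h x = y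
    | .inr y, .inl x => x ∈ h.source ∧ h x = y
    | .inr y, .inr y' => y = y'
  iseqv :=
    { refl a := by cases a <;> simp
      symm {a b} hab := by cases a <;> cases b <;> simp_all
      trans {a b c} hab hbc := by
        rcases a with x | y <;> rcases b with x' | y' <;> rcases c with x'' | y'' <;>
          simp only at hab hbc ⊢
        · exact hab.trans hbc
        · exact hab ▸ hbc
        · exact h.injOn hab.1 hbc.1 (hab.2.trans hbc.2.symm)
        · exact ⟨hab.1, hab.2.trans hbc⟩
        · exact hbc ▸ hab
        · exact hab.2.symm.trans hbc.2
        · exact ⟨hbc.1, hbc.2.trans hab.symm⟩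
        · exact hab.trans hbc }

/-- The space `X ∪_h Y`, for manifolds `X` and `Y` with an arbitrary common model and a
diffeomorphism `h` between open subsets. It has the quotient topology. -/
def ModelGlue (h : PartialDiffeomorph I I X Y ∞) : Type (max u v) :=
  Quotient (modelGlueSetoid h)

instance (h : PartialDiffeomorph I I X Y ∞) : TopologicalSpace (ModelGlue h) :=
  inferInstanceAs (TopologicalSpace (Quotient (modelGlueSetoid h)))

namespace ModelGlue

variable (h : PartialDiffeomorph I I X Y ∞)

/-- The inclusion of the first piece. -/
def inl (x : X) : ModelGlue h := Quotient.mk (modelGlueSetoid h) (.inl x)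

/-- The inclusion of the second piece. -/
def inr (y : Y) : ModelGlue h := Quotient.mk (modelGlueSetoid h) (.inr y)

theorem inl_injective : Function.Injective (inl h) := fun _ _ hx =>
  Quotient.exact (s := modelGlueSetoid h) hx

theorem inr_injective : Function.Injective (inr h) := fun _ _ hx =>
  Quotient.exact (s := modelGlueSetoid h) hx

theorem inl_eq_inr {x : X} {y : Y} : inl h x = inr h y ↔ x ∈ h.source ∧ h x = y :=
  Quotient.eq (r := modelGlueSetoid h)

theorem inl_mem_range_inr {x : X} : inl h x ∈ range (inr h) ↔ x ∈ h.source :=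
  ⟨fun ⟨_, hy⟩ => ((inl_eq_inr h).1 hy.symm).1, fun hx => ⟨h x, ((inl_eq_inr h).2 ⟨hx, rfl⟩).symm⟩⟩

theorem inr_mem_range_inl {y : Y} : inr h y ∈ range (inl h) ↔ y ∈ h.target := by
  refine ⟨fun ⟨x, hx⟩ => ?_, fun hy => ⟨h.symm y, (inl_eq_inr h).2 ⟨h.map_target hy, ?_⟩⟩⟩
  · obtain ⟨h1, rfl⟩ := (inl_eq_inr h).1 hx
    exact h.map_source h1
  · exact h.right_inv hy

theorem mem_range (q : ModelGlue h) : q ∈ range (inl h) ∨ q ∈ range (inr h) := by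
  induction q using Quotient.inductionOn with
  | h a => cases a with
    | inl x => exact .inl ⟨x, rfl⟩
    | inr y => exact .inr ⟨y, rfl⟩

theorem isOpen_iff {s : Set (ModelGlue h)} :
    IsOpen s ↔ IsOpen (inl h ⁻¹' s) ∧ IsOpen (inr h ⁻¹' s) :=
  isOpen_coinduced.trans isOpen_sum_iff

theorem isOpenEmbedding_inl : IsOpenEmbedding (inl h) := by
  refine .of_continuous_injective_isOpenMap ?_ (inl_injective h) fun s hs => ?_
  · exact continuous_def.2 fun s hs => ((isOpen_iff h).1 hs).1
  · refine (isOpen_iff h).2 ⟨by rwa [preimage_image_eq _ (inl_injective h)], ?_⟩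
    convert! h.toOpenPartialHomeomorph.isOpen_image_source_inter hs using 1
    ext y
    simp only [mem_preimage, mem_image, inl_eq_inr, mem_inter_iff]
    exact ⟨fun ⟨x, hx, hxs, hxy⟩ => ⟨x, ⟨hxs, hx⟩, hxy⟩,
      fun ⟨x, ⟨hxs, hx⟩, hxy⟩ => ⟨x, hx, hxs, hxy⟩⟩

theorem isOpenEmbedding_inr : IsOpenEmbedding (inr h) := by
  refine .of_continuous_injective_isOpenMap ?_ (inr_injective h) fun s hs => ?_
  · exact continuous_def.2 fun s hs => ((isOpen_iff h).1 hs).2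
  · refine (isOpen_iff h).2 ⟨?_, by rwa [preimage_image_eq _ (inr_injective h)]⟩
    convert! h.toOpenPartialHomeomorph.isOpen_inter_preimage hs using 1
    ext x
    simp only [mem_preimage, mem_image, eq_comm (b := inl h x), inl_eq_inr, mem_inter_iff]
    exact ⟨fun ⟨y, hy, hx, hxy⟩ => ⟨hx, by rw [← hxy] at hy; exact hy⟩,
      fun ⟨hx, hxy⟩ => ⟨_, hxy, hx, rfl⟩⟩

/-- The map on `X ∪_h Y` given by compatible maps on the two pieces. -/
def lift {Z : Type*} (f : X → Z) (g : Y → Z) (hfg : ∀ x ∈ h.source, f x = g (h x)) :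
    ModelGlue h → Z :=
  Quotient.lift (Sum.elim f g) (by
    rintro (x | y) (x' | y') hxy
    · exact congrArg f hxy
    · exact (hfg x hxy.1).trans (congrArg g hxy.2)
    · exact ((hfg x' hxy.1).trans (congrArg g hxy.2)).symm
    · exact congrArg g hxy)

variable [Nonempty H]

open Classical in
/-- The smooth atlas of `X ∪_h Y`: the charts of `X` and the charts of `Y`. -/
noncomputable instance : ChartedSpace H (ModelGlue h) where
  atlas := ((fun e => e.lift_openEmbedding (isOpenEmbedding_inl h)) '' atlas H X) ∪
    ((fun e => e.lift_openEmbedding (isOpenEmbedding_inr h)) '' atlas H Y)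
  chartAt q := if hq : q ∈ range (inl h)
    then (chartAt H hq.choose).lift_openEmbedding (isOpenEmbedding_inl h)
    else (chartAt H ((mem_range h q).resolve_left hq).choose).lift_openEmbedding
      (isOpenEmbedding_inr h)
  mem_chart_source q := by
    split_ifs with hq
    · exact ⟨_, mem_chart_source _ _, hq.choose_spec⟩
    · exact ⟨_, mem_chart_source _ _, ((mem_range h q).resolve_left hq).choose_spec⟩
  chart_mem_atlas q := by
    split_ifs with hq
    · exact .inl ⟨_, chart_mem_atlas _ _, rfl⟩
    · exact .inr ⟨_, chart_mem_atlas _ _, rfl⟩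

variable [IsManifold I ∞ X] [IsManifold I ∞ Y]

instance : IsManifold I ∞ (ModelGlue h) := by
  refine isManifold_of_contDiffOn _ _ _ ?_
  rintro _ _ (⟨e, he, rfl⟩ | ⟨e, he, rfl⟩) (⟨f, hf, rfl⟩ | ⟨f, hf, rfl⟩)
  · exact contDiffOn_transition_of_isOpenEmbedding _ _ contMDiffOn_id (fun _ _ => rfl) he hf
  · refine contDiffOn_transition_of_isOpenEmbedding _ _ (t := h) ?_ ?_ he hf
    · simpa only [inl_mem_range_inr] using! h.contMDiffOn
    · exact fun x hx => ((inl_eq_inr h).2 ⟨(inl_mem_range_inr h).1 hx, rfl⟩).symm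
  · refine contDiffOn_transition_of_isOpenEmbedding _ _ (t := h.symm) ?_ ?_ he hf
    · simpa only [inr_mem_range_inl] using! h.symm.contMDiffOn
    · intro y hy
      have hy := (inr_mem_range_inl h).1 hy
      exact (inl_eq_inr h).2 ⟨h.map_target hy, h.right_inv hy⟩
  · exact contDiffOn_transition_of_isOpenEmbedding _ _ contMDiffOn_id (fun _ _ => rfl) he hf

/-- The inclusion of the first piece is a diffeomorphism onto an open subset. -/
noncomputable def inlDiffeo [Nonempty X] : PartialDiffeomorph I I X (ModelGlue h) ∞ :=
  diffeoOfIsOpenEmbedding (isOpenEmbedding_inl h) fun _ he => .inl ⟨_, he, rfl⟩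

/-- The inclusion of the second piece is a diffeomorphism onto an open subset. -/
noncomputable def inrDiffeo [Nonempty Y] : PartialDiffeomorph I I Y (ModelGlue h) ∞ :=
  diffeoOfIsOpenEmbedding (isOpenEmbedding_inr h) fun _ he => .inr ⟨_, he, rfl⟩

end ModelGlue

end ModelGlue

/-- The inclusion of the first piece of `X ∪_h Y` is a diffeomorphism onto an open subset. -/
noncomputable def Glue.inlDiffeo {n : ℕ} {X : Type u} [TopologicalSpace X] [ChartedSpace (Euc n) X]
    {Y : Type v} [TopologicalSpace Y] [ChartedSpace (Euc n) Y]
    (h : PartialDiffeomorph (𝓡 n) (𝓡 n) X Y ∞) [IsManifold (𝓡 n) ∞ X] [IsManifold (𝓡 n) ∞ Y]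
    [Nonempty X] : PartialDiffeomorph (𝓡 n) (𝓡 n) X (Glue h) ∞ :=
  diffeoOfIsOpenEmbedding (isOpenEmbedding_inl h) fun _ he => .inl ⟨_, he, rfl⟩

/-! ### Trivial `G`-`G`-bundles -/

section TrivialBundle

variable {G : Type*} [Group G] {X : Type*} [MulAction G X]

/-- The action `(r, s) (x, g) = (r x, s g r⁻¹)` of `G × G` on the trivial principal bundle `X × G`
over a `G`-space `X`. -/
def trivialAct (a : G × G) (z : X × G) : X × G := (a.1 • z.1, a.2 * z.2 * a.1⁻¹)

theorem trivialAct_one (z : X × G) : trivialAct 1 z = z := by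
  simp [trivialAct]

theorem trivialAct_mul (a b : G × G) (z : X × G) :
    trivialAct (a * b) z = trivialAct a (trivialAct b z) := by
  simp [trivialAct, mul_smul, mul_assoc]

theorem trivialAct_eq_iff {a : G × G} {z : X × G} :
    trivialAct a z = z ↔ ∃ h : G, h • z.1 = z.1 ∧ a = (h, z.2 * h * z.2⁻¹) := by
  obtain ⟨r, s⟩ := a
  obtain ⟨x, g⟩ := z
  simp only [trivialAct, Prod.mk.injEq]
  constructor
  · rintro ⟨h1, h2⟩
    refine ⟨r, h1, rfl, ?_⟩
    rw [mul_inv_eq_iff_eq_mul] at h2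
    rw [← h2]
    group
  · rintro ⟨h, h1, rfl, rfl⟩
    exact ⟨h1, by group⟩

/-- The involution `(x, g) ↦ (g x, g⁻¹)` of `X × G`. It exchanges the actions of the two factors of
`G × G`, and hence turns the quotient by the first factor into the projection to `X`. -/
def actionTwist (z : X × G) : X × G := (z.2 • z.1, z.2⁻¹)

theorem actionTwist_actionTwist (z : X × G) : actionTwist (actionTwist z) = z := by
  simp [actionTwist]

variable {n k : ℕ} [TopologicalSpace G] [ChartedSpace (Euc k) G] [LieGroup (𝓡 k) ∞ G]
  [TopologicalSpace X] [ChartedSpace (Euc n) X] [ContMDiffSMul (𝓡 k) (𝓡 n) ∞ G X]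

theorem contMDiff_trivialAct :
    ContMDiff (((𝓡 k).prod (𝓡 k)).prod ((𝓡 n).prod (𝓡 k))) ((𝓡 n).prod (𝓡 k)) ∞
      fun z : (G × G) × (X × G) => trivialAct z.1 z.2 := by
  have h1 : ContMDiff (((𝓡 k).prod (𝓡 k)).prod ((𝓡 n).prod (𝓡 k))) (𝓡 k) ∞
      fun z : (G × G) × (X × G) => z.1.1 := contMDiff_fst.fst
  have h2 : ContMDiff (((𝓡 k).prod (𝓡 k)).prod ((𝓡 n).prod (𝓡 k))) (𝓡 k) ∞
      fun z : (G × G) × (X × G) => z.1.2 := contMDiff_fst.snd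
  have h3 : ContMDiff (((𝓡 k).prod (𝓡 k)).prod ((𝓡 n).prod (𝓡 k))) (𝓡 n) ∞
      fun z : (G × G) × (X × G) => z.2.1 := contMDiff_snd.fst
  have h4 : ContMDiff (((𝓡 k).prod (𝓡 k)).prod ((𝓡 n).prod (𝓡 k))) (𝓡 k) ∞
      fun z : (G × G) × (X × G) => z.2.2 := contMDiff_snd.snd
  exact ((contMDiff_smul (I := 𝓡 k) (I' := 𝓡 n) (n := ∞) (G := G) (M := X)).comp
    (h1.prodMk h3)).prodMk ((h2.mul h4).mul h1.inv)

theorem contMDiff_actionTwist :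
    ContMDiff ((𝓡 n).prod (𝓡 k)) ((𝓡 n).prod (𝓡 k)) ∞ (actionTwist : X × G → X × G) :=
  ((contMDiff_smul (I := 𝓡 k) (I' := 𝓡 n) (n := ∞) (G := G) (M := X)).comp
    (contMDiff_snd.prodMk contMDiff_fst)).prodMk contMDiff_snd.inv

/-- The involution `actionTwist` as a diffeomorphism. -/
def actionTwistDiffeo :
    PartialDiffeomorph ((𝓡 n).prod (𝓡 k)) ((𝓡 n).prod (𝓡 k)) (X × G) (X × G) ∞ where
  toFun := actionTwist
  invFun := actionTwist
  source := univ
  target := univ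
  map_source' _ _ := mem_univ _
  map_target' _ _ := mem_univ _
  left_inv' z _ := actionTwist_actionTwist z
  right_inv' z _ := actionTwist_actionTwist z
  open_source := isOpen_univ
  open_target := isOpen_univ
  contMDiffOn_toFun := contMDiff_actionTwist.contMDiffOn
  contMDiffOn_invFun := contMDiff_actionTwist.contMDiffOn

end TrivialBundle

section PrincipalBundle

variable {n k : ℕ} {G : Type*} [Group G] [TopologicalSpace G] [ChartedSpace (Euc k) G]
  {P : Type*} [TopologicalSpace P] [ChartedSpace (ModelProd (Euc n) (Euc k)) P]
  {M : Type*} [TopologicalSpace M] [ChartedSpace (Euc n) M]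
  {X : Type*} [TopologicalSpace X] [ChartedSpace (Euc n) X]

/-- An open piece `X × G` of the total space, lying over an open piece `X` of the base,
is a local trivialization. -/
theorem exists_trivialization {act : G → P → P} {π : P → M}
    (D : PartialDiffeomorph ((𝓡 n).prod (𝓡 k)) ((𝓡 n).prod (𝓡 k)) (X × G) P ∞)
    (hD : D.source = univ)
    (c : PartialDiffeomorph (𝓡 n) (𝓡 n) X M ∞) (hc : c.source = univ)
    (hact : ∀ s x g, act s (D (x, g)) = D (x, s * g)) (hπ : ∀ x g, π (D (x, g)) = c x)
    (hpre : ∀ q, π q ∈ c.target → q ∈ D.target) {x : M} (hx : x ∈ c.target) :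
    ∃ U : Set M, IsOpen U ∧ x ∈ U ∧
    ∃ Φ : PartialDiffeomorph ((𝓡 n).prod (𝓡 k)) ((𝓡 n).prod (𝓡 k)) P (M × G) ∞,
      Φ.source = π ⁻¹' U ∧ Φ.target = U ×ˢ univ ∧
      ∀ q ∈ π ⁻¹' U, (Φ q).1 = π q ∧ ∀ s, Φ (act s q) = (π q, s * (Φ q).2) := by
  have hsource : D.target = π ⁻¹' c.target := by
    refine Subset.antisymm (fun q hq => ?_) hpre
    obtain ⟨⟨x, g⟩, rfl⟩ : q ∈ range D := by rwa [← PartialDiffeomorph.target_eq_range hD]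
    rw [mem_preimage, hπ]
    exact c.map_source (by simp [hc])
  refine ⟨c.target, c.open_target, hx,
    D.symm.trans (c.prodMap (Diffeomorph.refl (𝓡 k) G ∞).toPartialDiffeomorph), ?_, ?_, ?_⟩
  · change D.target ∩ D.symm ⁻¹' (c.source ×ˢ univ) = _
    rw [hc, univ_prod_univ, preimage_univ, inter_univ, hsource]
  · change (c.target ×ˢ univ) ∩ _ ⁻¹' D.source = _
    rw [hD, preimage_univ, inter_univ]
  · intro q hq
    obtain ⟨⟨x, g⟩, rfl⟩ : q ∈ range D := by
      rw [← PartialDiffeomorph.target_eq_range hD, hsource]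
      exact hq
    have key : ∀ y t, (D.symm.trans (c.prodMap
        (Diffeomorph.refl (𝓡 k) G ∞).toPartialDiffeomorph)) (D (y, t)) = (c y, t) := by
      intro y t
      change (c (D.symm (D (y, t))).1, (D.symm (D (y, t))).2) = _
      rw [PartialDiffeomorph.left_inv_of_source_univ hD]
    refine ⟨?_, fun s => ?_⟩
    · rw [key, hπ]
    · rw [hact, key, key, hπ]

end PrincipalBundle

/-! ### Gluing two trivial `G`-`G`-bundles -/

section GlueBundles

variable {n k : ℕ} {G : Type*} [Group G] [TopologicalSpace G] [ChartedSpace (Euc k) G]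
  {X : Type u} [TopologicalSpace X] [ChartedSpace (Euc n) X] [MulAction G X]
  {Y : Type v} [TopologicalSpace Y] [ChartedSpace (Euc n) Y] [MulAction G Y]

/-- A gluing map of the trivial bundles `X × G` and `Y × G` that commutes with `G × G`. -/
structure IsBiequivariant
    (h : PartialDiffeomorph ((𝓡 n).prod (𝓡 k)) ((𝓡 n).prod (𝓡 k)) (X × G) (Y × G) ∞) : Prop where
  act_mem_source : ∀ a, ∀ z ∈ h.source, trivialAct a z ∈ h.source
  map_act : ∀ a, ∀ z ∈ h.source, h (trivialAct a z) = trivialAct a (h z)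

variable {h : PartialDiffeomorph ((𝓡 n).prod (𝓡 k)) ((𝓡 n).prod (𝓡 k)) (X × G) (Y × G) ∞}

namespace IsBiequivariant

theorem act_mem_target (hh : IsBiequivariant h) (a : G × G) {w : Y × G} (hw : w ∈ h.target) :
    trivialAct a w ∈ h.target := by
  obtain ⟨z, hz, rfl⟩ : w ∈ h '' h.source := h.image_source_eq_target.symm ▸ hw
  rw [← hh.map_act a z hz]
  exact h.map_source (hh.act_mem_source a z hz)

/-- The action of `G × G` on the union of two trivial bundles. -/
@[reducible] noncomputable def mulAction (hh : IsBiequivariant h) : MulAction (G × G) (ModelGlue h) where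
  smul a := ModelGlue.lift h (fun z => ModelGlue.inl h (trivialAct a z))
    (fun w => ModelGlue.inr h (trivialAct a w)) fun z hz =>
      (ModelGlue.inl_eq_inr h).2 ⟨hh.act_mem_source a z hz, hh.map_act a z hz⟩
  one_smul q := by
    rcases ModelGlue.mem_range h q with ⟨z, rfl⟩ | ⟨w, rfl⟩
    · exact congrArg (ModelGlue.inl h) (trivialAct_one z)
    · exact congrArg (ModelGlue.inr h) (trivialAct_one w)
  mul_smul a b q := by
    rcases ModelGlue.mem_range h q with ⟨z, rfl⟩ | ⟨w, rfl⟩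
    · exact congrArg (ModelGlue.inl h) (trivialAct_mul a b z)
    · exact congrArg (ModelGlue.inr h) (trivialAct_mul a b w)

variable {M : Type*} [TopologicalSpace M] [ChartedSpace (Euc n) M]
  {Q : Type*} [TopologicalSpace Q] [ChartedSpace (Euc n) Q]
  {c₁ : PartialDiffeomorph (𝓡 n) (𝓡 n) X M ∞} {c₂ : PartialDiffeomorph (𝓡 n) (𝓡 n) Y M ∞}
  {d₁ : PartialDiffeomorph (𝓡 n) (𝓡 n) X Q ∞} {d₂ : PartialDiffeomorph (𝓡 n) (𝓡 n) Y Q ∞}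

/-- If the fibre of the second piece over `y` lies over a point of the first piece, all of it is
glued: `h` hits one point of this fibre, and its target is invariant under `{1} × G`. -/
theorem mem_target_of_base (hh : IsBiequivariant h) (hc₂ : c₂.source = univ)
    (hM₁ : ∀ z ∈ h.source, c₂ (h z).1 = c₁ z.1)
    (hM₂ : ∀ x y, c₁ x = c₂ y → ∀ g, (x, g) ∈ h.source) {x : X} {w : Y × G}
    (hw : c₁ x = c₂ w.1) : w ∈ h.target := by
  have h1 := hM₂ x w.1 hw 1
  have h2 : (h (x, 1)).1 = w.1 :=
    c₂.injOn (by simp [hc₂]) (by simp [hc₂]) ((hM₁ _ h1).trans hw)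
  have h3 : w = trivialAct (1, w.2 * (h (x, 1)).2⁻¹) (h (x, 1)) := by
    simp [trivialAct, h2]
  rw [h3]
  exact hh.act_mem_target _ (h.map_source h1)

theorem mem_source_of_quotient (hh : IsBiequivariant h)
    (hQ₂ : ∀ x y, d₁ x = d₂ y → ∀ g, (x, g) ∈ h.source) {z : X × G} {y : Y}
    (hz : d₁ (z.2 • z.1) = d₂ y) : z ∈ h.source := by
  have h1 := hh.act_mem_source (z.2⁻¹, 1) _ (hQ₂ _ _ hz 1)
  simpa [trivialAct] using h1

theorem mem_target_of_quotient (hh : IsBiequivariant h) (hd₂ : d₂.source = univ)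
    (hQ₁ : ∀ z ∈ h.source, d₂ ((h z).2 • (h z).1) = d₁ (z.2 • z.1))
    (hQ₂ : ∀ x y, d₁ x = d₂ y → ∀ g, (x, g) ∈ h.source) {x : X} {w : Y × G}
    (hw : d₁ x = d₂ (w.2 • w.1)) : w ∈ h.target := by
  have h1 := hQ₂ _ _ hw 1
  have h2 : (h (x, 1)).2 • (h (x, 1)).1 = w.2 • w.1 :=
    d₂.injOn (by simp [hd₂]) (by simp [hd₂]) ((hQ₁ _ h1).trans (by simpa using hw))
  have h3 : w = trivialAct (w.2⁻¹ * (h (x, 1)).2, 1) (h (x, 1)) := by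
    simp [trivialAct, mul_smul, h2]
  rw [h3]
  exact hh.act_mem_target _ (h.map_source h1)

/-- Let `X` and `Y` be `G`-manifolds, embedded as open subsets in the `G`-manifold `M` by the
equivariant maps `c₁`, `c₂` and in `Q` by maps `d₁`, `d₂`, and let `h` be a biequivariant gluing map
of `X × G` and `Y × G`. If `h` covers the identity of `M` with respect to the bundle projections
`(x, g) ↦ x`, and the identity of `Q` with respect to the quotient maps `(x, g) ↦ g x`, then
`M ← X × G ∪_h Y × G → Q` is a `G`-`G`-bundle. -/
theorem exists_isGGBundle [LieGroup (𝓡 k) ∞ G] [T2Space G] [SecondCountableTopology G]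
    [MulAction G M] [T2Space M]
    [T2Space X] [SecondCountableTopology X] [IsManifold (𝓡 n) ∞ X] [Nonempty X]
    [ContMDiffSMul (𝓡 k) (𝓡 n) ∞ G X]
    [T2Space Y] [SecondCountableTopology Y] [IsManifold (𝓡 n) ∞ Y] [Nonempty Y]
    [ContMDiffSMul (𝓡 k) (𝓡 n) ∞ G Y]
    (hh : IsBiequivariant h)
    (hc₁ : c₁.source = univ) (hc₂ : c₂.source = univ)
    (hc₁G : ∀ (g : G) x, c₁ (g • x) = g • c₁ x) (hc₂G : ∀ (g : G) y, c₂ (g • y) = g • c₂ y)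
    (hcover : ∀ x, x ∈ c₁.target ∨ x ∈ c₂.target)
    (hM₁ : ∀ z ∈ h.source, c₂ (h z).1 = c₁ z.1)
    (hM₂ : ∀ x y, c₁ x = c₂ y → ∀ g, (x, g) ∈ h.source)
    (hd₁ : d₁.source = univ) (hd₂ : d₂.source = univ)
    (hdcover : ∀ x, x ∈ d₁.target ∨ x ∈ d₂.target)
    (hQ₁ : ∀ z ∈ h.source, d₂ ((h z).2 • (h z).1) = d₁ (z.2 • z.1))
    (hQ₂ : ∀ x y, d₁ x = d₂ y → ∀ g, (x, g) ∈ h.source) :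
    ∃ (_ : MulAction (G × G) (ModelGlue h)) (π : ModelGlue h → M) (π' : ModelGlue h → Q),
      T2Space (ModelGlue h) ∧ SecondCountableTopology (ModelGlue h) ∧
      IsGGBundle n k G π π' := by
  let _ := hh.mulAction
  have smul_inl : ∀ (a : G × G) z, a • ModelGlue.inl h z = ModelGlue.inl h (trivialAct a z) :=
    fun _ _ => rfl
  have smul_inr : ∀ (a : G × G) w, a • ModelGlue.inr h w = ModelGlue.inr h (trivialAct a w) :=
    fun _ _ => rfl
  have range₁ : ∀ {q}, q ∈ (ModelGlue.inlDiffeo h).target ↔ q ∈ range (ModelGlue.inl h) := by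
    intro q
    rw [PartialDiffeomorph.target_eq_range (a := ModelGlue.inlDiffeo h) rfl]
    rfl
  have range₂ : ∀ {q}, q ∈ (ModelGlue.inrDiffeo h).target ↔ q ∈ range (ModelGlue.inr h) := by
    intro q
    rw [PartialDiffeomorph.target_eq_range (a := ModelGlue.inrDiffeo h) rfl]
    rfl
  have rc₁ := PartialDiffeomorph.target_eq_range hc₁
  have rc₂ := PartialDiffeomorph.target_eq_range hc₂
  have rd₁ := PartialDiffeomorph.target_eq_range hd₁
  have rd₂ := PartialDiffeomorph.target_eq_range hd₂
  let π : ModelGlue h → M := ModelGlue.lift h (fun z => c₁ z.1) (fun w => c₂ w.1)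
    fun z hz => (hM₁ z hz).symm
  let π' : ModelGlue h → Q := ModelGlue.lift h (fun z => d₁ (z.2 • z.1)) (fun w => d₂ (w.2 • w.1))
    fun z hz => (hQ₁ z hz).symm
  have hπ₁ : ∀ z, π (ModelGlue.inl h z) = c₁ z.1 := fun _ => rfl
  have hπ₂ : ∀ w, π (ModelGlue.inr h w) = c₂ w.1 := fun _ => rfl
  have hπ'₁ : ∀ z, π' (ModelGlue.inl h z) = d₁ (z.2 • z.1) := fun _ => rfl
  have hπ'₂ : ∀ w, π' (ModelGlue.inr h w) = d₂ (w.2 • w.1) := fun _ => rfl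
  refine ⟨inferInstance, π, π', ?_, ?_, ?_, ?_, ?_, ?_, ?_⟩
  · -- The gluing relation is closed: where base points agree, the graph of `h` is closed.
    refine t2Space_of_isOpenEmbedding_cover (ModelGlue.isOpenEmbedding_inl h)
      (ModelGlue.isOpenEmbedding_inr h) (ModelGlue.mem_range h) ?_
    have k₁ : Continuous c₁ := (PartialDiffeomorph.contMDiff_of_source_univ hc₁).continuous
    have k₂ : Continuous c₂ := (PartialDiffeomorph.contMDiff_of_source_univ hc₂).continuous
    have hC : IsClosed {z : (X × G) × (Y × G) | c₁ z.1.1 = c₂ z.2.1} :=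
      isClosed_eq (k₁.comp (continuous_fst.comp continuous_fst))
        (k₂.comp (continuous_fst.comp continuous_snd))
    have hcont : ContinuousOn (fun z : (X × G) × (Y × G) => (h z.1, z.2))
        {z : (X × G) × (Y × G) | c₁ z.1.1 = c₂ z.2.1} :=
      (h.contMDiffOn.continuousOn.comp continuousOn_fst
        fun z hz => hM₂ _ _ hz z.1.2).prodMk continuousOn_snd
    convert hcont.preimage_isClosed_of_isClosed hC isClosed_diagonal using 1
    ext ⟨z, w⟩
    simp only [mem_ofPred_eq, ModelGlue.inl_eq_inr, mem_inter_iff, mem_preimage, mem_diagonal_iff]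
    exact ⟨fun ⟨h1, h2⟩ => ⟨by rw [← h2]; exact (hM₁ z h1).symm, h2⟩,
      fun ⟨h1, h2⟩ => ⟨hM₂ _ _ h1 z.2, h2⟩⟩
  · exact secondCountable_of_isOpenEmbedding_cover (ModelGlue.isOpenEmbedding_inl h)
      (ModelGlue.isOpenEmbedding_inr h) (ModelGlue.mem_range h)
  · refine ⟨PartialDiffeomorph.contMDiff_of_cover (a := ModelGlue.inlDiffeo h)
      (b := ModelGlue.inrDiffeo h) ?_ ?_ ?_⟩
    · simpa only [range₁, range₂] using ModelGlue.mem_range h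
    · exact (PartialDiffeomorph.contMDiff_of_source_univ (a := ModelGlue.inlDiffeo h) rfl).comp
        contMDiff_trivialAct
    · exact (PartialDiffeomorph.contMDiff_of_source_univ (a := ModelGlue.inrDiffeo h) rfl).comp
        contMDiff_trivialAct
  · refine ⟨fun s q => ?_, fun x => ?_⟩
    · rcases ModelGlue.mem_range h q with ⟨z, rfl⟩ | ⟨w, rfl⟩
      · rw [smul_inl, hπ₁, hπ₁]
        simp [trivialAct]
      · rw [smul_inr, hπ₂, hπ₂]
        simp [trivialAct]
    · rcases hcover x with hx | hx
      · refine exists_trivialization (ModelGlue.inlDiffeo h) rfl c₁ hc₁ (fun s x g => ?_)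
          (fun x g => rfl) (fun q hq => range₁.2 ?_) hx
        · refine (smul_inl _ _).trans (congrArg (ModelGlue.inl h) ?_)
          simp [trivialAct]
        · rcases ModelGlue.mem_range h q with hq' | ⟨w, rfl⟩
          · exact hq'
          · rw [rc₁] at hq
            obtain ⟨x, hx⟩ := hq
            exact (ModelGlue.inr_mem_range_inl h).2 (hh.mem_target_of_base hc₂ hM₁ hM₂ hx)
      · refine exists_trivialization (ModelGlue.inrDiffeo h) rfl c₂ hc₂ (fun s x g => ?_)
          (fun x g => rfl) (fun q hq => range₂.2 ?_) hx
        · refine (smul_inr _ _).trans (congrArg (ModelGlue.inr h) ?_)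
          simp [trivialAct]
        · rcases ModelGlue.mem_range h q with ⟨z, rfl⟩ | hq'
          · rw [rc₂] at hq
            obtain ⟨y, hy⟩ := hq
            exact (ModelGlue.inl_mem_range_inr h).2 (hM₂ _ _ hy.symm z.2)
          · exact hq'
  · refine ⟨fun r q => ?_, fun x => ?_⟩
    · rcases ModelGlue.mem_range h q with ⟨z, rfl⟩ | ⟨w, rfl⟩
      · rw [smul_inl, hπ'₁, hπ'₁]
        simp [trivialAct, mul_smul]
      · rw [smul_inr, hπ'₂, hπ'₂]
        simp [trivialAct, mul_smul]
    · -- The involution turns the `⋆`-action into the principal action of the trivial bundle.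
      rcases hdcover x with hx | hx
      · refine exists_trivialization (actionTwistDiffeo.trans (ModelGlue.inlDiffeo h)) ?_ d₁ hd₁
          (fun r x g => ?_) (fun x g => ?_) (fun q hq => ?_) hx
        · change univ ∩ _ ⁻¹' univ = univ
          simp
        · refine (smul_inl _ _).trans (congrArg (ModelGlue.inl h) ?_)
          change trivialAct _ (actionTwist (x, g)) = actionTwist (x, r * g)
          simp [trivialAct, actionTwist, mul_smul]
        · change d₁ ((actionTwist (x, g)).2 • (actionTwist (x, g)).1) = d₁ x
          simp [actionTwist]
        · refine ⟨range₁.2 ?_, mem_univ _⟩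
          rcases ModelGlue.mem_range h q with hq' | ⟨w, rfl⟩
          · exact hq'
          · rw [rd₁] at hq
            obtain ⟨x, hx⟩ := hq
            exact (ModelGlue.inr_mem_range_inl h).2 (hh.mem_target_of_quotient hd₂ hQ₁ hQ₂ hx)
      · refine exists_trivialization (actionTwistDiffeo.trans (ModelGlue.inrDiffeo h)) ?_ d₂ hd₂
          (fun r x g => ?_) (fun x g => ?_) (fun q hq => ?_) hx
        · change univ ∩ _ ⁻¹' univ = univ
          simp
        · refine (smul_inr _ _).trans (congrArg (ModelGlue.inr h) ?_)
          change trivialAct _ (actionTwist (x, g)) = actionTwist (x, r * g)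
          simp [trivialAct, actionTwist, mul_smul]
        · change d₂ ((actionTwist (x, g)).2 • (actionTwist (x, g)).1) = d₂ x
          simp [actionTwist]
        · refine ⟨range₂.2 ?_, mem_univ _⟩
          rcases ModelGlue.mem_range h q with ⟨z, rfl⟩ | hq'
          · rw [rd₂] at hq
            obtain ⟨y, hy⟩ := hq
            exact (ModelGlue.inl_mem_range_inr h).2 (hh.mem_source_of_quotient hQ₂ hy.symm)
          · exact hq'
  · intro r q
    rcases ModelGlue.mem_range h q with ⟨z, rfl⟩ | ⟨w, rfl⟩
    · exact hc₁G r z.1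
    · exact hc₂G r w.1
  · intro q
    rcases ModelGlue.mem_range h q with ⟨z, rfl⟩ | ⟨w, rfl⟩
    · refine ⟨z.2, Set.ext fun a => ?_⟩
      have hfix : ∀ t : G, t • c₁ z.1 = c₁ z.1 ↔ t • z.1 = z.1 := fun t => by
        rw [← hc₁G]
        exact ⟨fun e => c₁.injOn (by simp [hc₁]) (by simp [hc₁]) e, congrArg c₁⟩
      simp only [SetLike.mem_coe, MulAction.mem_stabilizer_iff, smul_inl,
        (ModelGlue.inl_injective h).eq_iff, trivialAct_eq_iff, mem_ofPred_eq, hπ₁, hfix]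
    · refine ⟨w.2, Set.ext fun a => ?_⟩
      have hfix : ∀ t : G, t • c₂ w.1 = c₂ w.1 ↔ t • w.1 = w.1 := fun t => by
        rw [← hc₂G]
        exact ⟨fun e => c₂.injOn (by simp [hc₂]) (by simp [hc₂]) e, congrArg c₂⟩
      simp only [SetLike.mem_coe, MulAction.mem_stabilizer_iff, smul_inr,
        (ModelGlue.inr_injective h).eq_iff, trivialAct_eq_iff, mem_ofPred_eq, hπ₂, hfix]

end IsBiequivariant

end GlueBundles

/-! ### The bundle of an equivariant disc -/

section EquivariantDisc

variable {m k : ℕ} {G : Type v} [Group G] [TopologicalSpace G] [ChartedSpace (Euc k) G]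

theorem inclusionDiffeo_target {M : Type u} [TopologicalSpace M] [ChartedSpace (Euc (m + 1)) M]
    (U : Opens M) [Nonempty U] : (inclusionDiffeo (m := m) U).target = U :=
  U.openPartialHomeomorphSubtypeCoe_target ‹_›

theorem coe_inclusionDiffeo_symm {M : Type u} [TopologicalSpace M] [ChartedSpace (Euc (m + 1)) M]
    (U : Opens M) [Nonempty U] {x : M} (hx : x ∈ U) :
    ((inclusionDiffeo (m := m) U).symm x : M) = x := by
  refine (inclusionDiffeo (m := m) U).right_inv ?_
  rwa [inclusionDiffeo_target]

variable [LieGroup (𝓡 k) ∞ G]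

/-- The diffeomorphism `(v, g) ↦ (v, g φ(v / |v|))` of `(ℝ^(m+1) \ {0}) × G`. -/
noncomputable def sphereShear {φ : UnitSphere m → G} (hφ : ContMDiff (𝓡 m) (𝓡 k) ∞ φ) :
    PartialDiffeomorph ((𝓡 (m + 1)).prod (𝓡 k)) ((𝓡 (m + 1)).prod (𝓡 k))
      (Euc (m + 1) × G) (Euc (m + 1) × G) ∞ where
  toFun z := (z.1, z.2 * φ (direction z.1))
  invFun z := (z.1, z.2 * (φ (direction z.1))⁻¹)
  source := {0}ᶜ ×ˢ univ
  target := {0}ᶜ ×ˢ univ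
  map_source' _ hz := ⟨hz.1, mem_univ _⟩
  map_target' _ hz := ⟨hz.1, mem_univ _⟩
  left_inv' z _ := by simp
  right_inv' z _ := by simp
  open_source := isOpen_compl_singleton.prod isOpen_univ
  open_target := isOpen_compl_singleton.prod isOpen_univ
  contMDiffOn_toFun := contMDiffOn_fst.prodMk (contMDiffOn_snd.mul
    (hφ.comp_contMDiffOn (contMDiffOn_direction.comp contMDiffOn_fst fun _ hz => hz.1)))
  contMDiffOn_invFun := contMDiffOn_fst.prodMk (contMDiffOn_snd.mul
    (hφ.comp_contMDiffOn (contMDiffOn_direction.comp contMDiffOn_fst fun _ hz => hz.1)).inv)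

variable {M : Type u} [TopologicalSpace M] [ChartedSpace (Euc (m + 1)) M]

/-- The clutching map `(v, g) ↦ (e v, g φ(v / |v|))`, for `v ≠ 0`, of trivial bundles over a disc
`e` and over an open subset `U`. -/
noncomputable def clutching {φ : UnitSphere m → G} (hφ : ContMDiff (𝓡 m) (𝓡 k) ∞ φ)
    (e : PartialDiffeomorph (𝓡 (m + 1)) (𝓡 (m + 1)) (Euc (m + 1)) M ∞)
    (U : Opens M) [Nonempty U] :
    PartialDiffeomorph ((𝓡 (m + 1)).prod (𝓡 k)) ((𝓡 (m + 1)).prod (𝓡 k))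
      (Euc (m + 1) × G) (U × G) ∞ :=
  (sphereShear hφ).trans ((e.trans (inclusionDiffeo U).symm).prodMap
    (Diffeomorph.refl (𝓡 k) G ∞).toPartialDiffeomorph)

theorem mem_clutching_source {φ : UnitSphere m → G} (hφ : ContMDiff (𝓡 m) (𝓡 k) ∞ φ)
    {e : PartialDiffeomorph (𝓡 (m + 1)) (𝓡 (m + 1)) (Euc (m + 1)) M ∞} (he : e.source = univ)
    {U : Opens M} [Nonempty U] (hU : ∀ v, e v ∈ U ↔ v ≠ 0) {z : Euc (m + 1) × G} :
    z ∈ (clutching hφ e U).source ↔ z.1 ≠ 0 := by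
  change z ∈ ({0}ᶜ ×ˢ univ : Set (Euc (m + 1) × G)) ∩ {z : Euc (m + 1) × G |
    z.1 ∈ e.source ∩ e ⁻¹' (inclusionDiffeo (m := m) U).target ∧ z.2 ∈ univ} ↔ _
  rw [inclusionDiffeo_target, he]
  simp [hU]

theorem clutching_fst {φ : UnitSphere m → G} (hφ : ContMDiff (𝓡 m) (𝓡 k) ∞ φ)
    {e : PartialDiffeomorph (𝓡 (m + 1)) (𝓡 (m + 1)) (Euc (m + 1)) M ∞}
    {U : Opens M} [Nonempty U] {z : Euc (m + 1) × G} (hz : e z.1 ∈ U) :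
    ((clutching hφ e U z).1 : M) = e z.1 :=
  coe_inclusionDiffeo_symm (m := m) U hz

theorem clutching_snd {φ : UnitSphere m → G} (hφ : ContMDiff (𝓡 m) (𝓡 k) ∞ φ)
    {e : PartialDiffeomorph (𝓡 (m + 1)) (𝓡 (m + 1)) (Euc (m + 1)) M ∞}
    {U : Opens M} [Nonempty U] {z : Euc (m + 1) × G} :
    (clutching hφ e U z).2 = z.2 * φ (direction z.1) := rfl

theorem direction_map (T : Euc (m + 1) ≃ₗᵢ[ℝ] Euc (m + 1)) {v : Euc (m + 1)} (hv : v ≠ 0) :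
    direction (T v) = sphereIsometry T (direction v) := by
  have hTv : T v ≠ 0 := by simpa using hv
  apply Subtype.ext
  change _ = T (direction v : Euc (m + 1))
  rw [coe_direction hTv, coe_direction hv, map_smul, T.norm_map]

/-- Let `e` be an equivariant disc around the fixed point `p`, and let `Q` be the manifold obtained
from `M \ {p}` and `ℝ^(m+1)` by identifying `v` with `e (ρ(φ(v/|v|)) v)`. The trivial bundles over
`ℝ^(m+1)` and over `M \ {p}`, glued by the clutching map of `φ`, form a `G`-`G`-bundle
`M ← P → Q`. -/
theorem exists_isGGBundle_of_equivariantDisc [T2Space G] [SecondCountableTopology G]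
    [T2Space M] [SecondCountableTopology M]
    [IsManifold (𝓡 (m + 1)) ∞ M] [MulAction G M] [ContMDiffSMul (𝓡 k) (𝓡 (m + 1)) ∞ G M]
    {p : M} (hp : ∀ g : G, g • p = p)
    (ρ : G →* (Euc (m + 1) ≃ₗᵢ[ℝ] Euc (m + 1)))
    (hρ : ContMDiff ((𝓡 k).prod (𝓡 (m + 1))) (𝓡 (m + 1)) ∞
      fun z : G × Euc (m + 1) => ρ z.1 z.2)
    {φ : UnitSphere m → G} (hφ : ContMDiff (𝓡 m) (𝓡 k) ∞ φ)
    (hconj : ∀ (g : G) (x : UnitSphere m), φ (sphereIsometry (ρ g) x) = g * φ x * g⁻¹)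
    {U : Opens M} [Nonempty U] (hU : ∀ x, x ∈ U ↔ x ≠ p)
    {e : PartialDiffeomorph (𝓡 (m + 1)) (𝓡 (m + 1)) (Euc (m + 1)) M ∞} (he : e.source = univ)
    (he₀ : e 0 = p) (heG : ∀ (g : G) v, e (ρ g v) = g • e v)
    {Q : Type*} [TopologicalSpace Q] [ChartedSpace (Euc (m + 1)) Q]
    {a : PartialDiffeomorph (𝓡 (m + 1)) (𝓡 (m + 1)) (Euc (m + 1)) Q ∞} (ha : a.source = univ)
    {b : PartialDiffeomorph (𝓡 (m + 1)) (𝓡 (m + 1)) U Q ∞} (hb : b.source = univ)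
    (hab : ∀ q, q ∈ a.target ∨ q ∈ b.target)
    (hglue : ∀ v x, a v = b x ↔ (x : M) = e (ρ (φ (direction v)) v)) :
    ∃ (P : Type (max u v)) (_ : TopologicalSpace P)
      (_ : ChartedSpace (ModelProd (Euc (m + 1)) (Euc k)) P) (_ : MulAction (G × G) P)
      (π : P → M) (π' : P → Q),
      T2Space P ∧ SecondCountableTopology P ∧
      IsManifold ((𝓡 (m + 1)).prod (𝓡 k)) ∞ P ∧ IsGGBundle (m + 1) k G π π' := by
  have heU : ∀ v, e v ∈ U ↔ v ≠ 0 := fun v => by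
    rw [hU, ← he₀, ne_eq, ne_eq, (e.injOn.eq_iff (by simp [he]) (by simp [he]))]
  let _ : MulAction G (Euc (m + 1)) :=
    { smul := fun g v => ρ g v
      one_smul := fun v => by change ρ 1 v = v; simp
      mul_smul := fun g g' v => by change ρ (g * g') v = ρ g (ρ g' v); simp }
  have smul_euc : ∀ (g : G) (v : Euc (m + 1)), g • v = ρ g v := fun _ _ => rfl
  have : ContMDiffSMul (𝓡 k) (𝓡 (m + 1)) ∞ G (Euc (m + 1)) := ⟨hρ⟩
  have hUG : ∀ (g : G) (x : U), g • (x : M) ∈ U := fun g x => by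
    rw [hU]
    intro h
    exact (hU x).1 x.2 (smul_left_cancel g (h.trans (hp g).symm))
  let _ : MulAction G U :=
    { smul := fun g x => ⟨g • (x : M), hUG g x⟩
      one_smul := fun x => Subtype.ext (one_smul G (x : M))
      mul_smul := fun g g' x => Subtype.ext (mul_smul g g' (x : M)) }
  have coe_smul : ∀ (g : G) (x : U), ((g • x : U) : M) = g • (x : M) := fun _ _ => rfl
  have : ContMDiffSMul (𝓡 k) (𝓡 (m + 1)) ∞ G U := by
    refine ⟨fun z => ?_⟩
    rw [← contMDiffWithinAt_univ]
    refine (ContMDiffWithinAt.subtypeVal_comp_iff U _ _ z).1 ?_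
    exact ((contMDiff_smul (I := 𝓡 k) (I' := 𝓡 (m + 1)) (n := ∞) (G := G) (M := M)).comp
      (contMDiff_fst.prodMk (contMDiff_subtype_val.comp contMDiff_snd))).contMDiffAt
  have hsource : ∀ {z}, z ∈ (clutching hφ e U).source ↔ z.1 ≠ 0 := mem_clutching_source hφ he heU
  have hfst : ∀ z ∈ (clutching hφ e U).source, ((clutching hφ e U z).1 : M) = e z.1 :=
    fun z hz => clutching_fst hφ ((heU _).2 (hsource.1 hz))
  have hdir : ∀ (g : G) {v}, v ≠ 0 → φ (direction (ρ g v)) = g * φ (direction v) * g⁻¹ :=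
    fun g v hv => by rw [direction_map _ hv, hconj]
  have hh : IsBiequivariant (clutching hφ e U) := by
    have hs : ∀ a, ∀ z ∈ (clutching hφ e U).source,
        trivialAct a z ∈ (clutching hφ e U).source := fun a z hz => by
      rw [hsource] at hz ⊢
      simpa [trivialAct, smul_euc] using hz
    refine ⟨hs, fun a z hz => Prod.ext (Subtype.ext ?_) ?_⟩
    · rw [hfst _ (hs a z hz)]
      simp only [trivialAct, smul_euc, coe_smul, hfst z hz, heG]
    · simp only [clutching_snd, trivialAct, smul_euc, hdir a.1 (hsource.1 hz)]
      group
  have hi : (inclusionDiffeo (m := m) U).source = univ := rfl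
  have hcover : ∀ x, x ∈ e.target ∨ x ∈ (inclusionDiffeo (m := m) U).target := by
    intro x
    by_cases hx : x = p
    · exact .inl (by rw [hx, ← he₀]; exact e.map_source (by simp [he]))
    · exact .inr ((PartialDiffeomorph.target_eq_range hi).symm ▸ ⟨⟨x, (hU x).2 hx⟩, rfl⟩)
  have hM₂ : ∀ (v : Euc (m + 1)) (x : U), e v = (x : M) → ∀ g : G,
      (v, g) ∈ (clutching hφ e U).source := fun v x hx g =>
    hsource.2 ((heU v).1 (hx ▸ x.2))
  have hQ₁ : ∀ z ∈ (clutching hφ e U).source,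
      b ((clutching hφ e U z).2 • (clutching hφ e U z).1) = a (z.2 • z.1) := by
    -- The value of `φ` at the direction of `g v` is `g φ(v/|v|) g⁻¹`.
    intro z hz
    refine ((hglue _ _).2 ?_).symm
    rw [coe_smul, hfst z hz, clutching_snd, smul_euc, hdir _ (hsource.1 hz), ← heG]
    simp
  have hQ₂ : ∀ (v : Euc (m + 1)) (x : U), a v = b x → ∀ g : G,
      (v, g) ∈ (clutching hφ e U).source := fun v x hx g => by
    have h4 := (hglue v x).1 hx
    have h5 := (heU _).1 (h4 ▸ x.2)
    exact hsource.2 fun hv => h5 (by simp_all)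
  obtain ⟨act, π, π', h1, h2, h3⟩ := hh.exists_isGGBundle (c₁ := e) (c₂ := inclusionDiffeo U)
    (d₁ := a) (d₂ := b) he hi (fun g v => heG g v) (fun g x => rfl) hcover hfst hM₂ ha hb hab hQ₁
    hQ₂
  exact ⟨_, _, _, act, π, π', h1, h2, inferInstance, h3⟩

end EquivariantDisc

/-! ### Realizing a germ by a diffeomorphism with compact support -/

section Germ

variable {E : Type*} [NormedAddCommGroup E] [NormedSpace ℝ E]

/-- A small enough Lipschitz perturbation of the identity is a diffeomorphism. -/
theorem exists_diffeomorph_id_add [CompleteSpace E] {w : E → E} (hw : ContDiff ℝ ∞ w)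
    {c : NNReal} (hc : c < 1) (hwc : LipschitzWith c w) :
    ∃ F : E ≃ₘ⟮𝓘(ℝ, E), 𝓘(ℝ, E)⟯ E, ∀ x, F x = x + w x := by
  have happrox : ApproximatesLinearOn (fun x => x + w x)
      ((ContinuousLinearEquiv.refl ℝ E : E ≃L[ℝ] E) : E →L[ℝ] E) univ c := by
    rw [ApproximatesLinearOn.approximatesLinearOn_iff_lipschitzOnWith, lipschitzOnWith_univ]
    convert hwc using 1
    ext x
    simp
  have hN : Subsingleton E ∨
      c < ‖((ContinuousLinearEquiv.refl ℝ E).symm : E →L[ℝ] E)‖₊⁻¹ := by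
    rcases subsingleton_or_nontrivial E with h | h
    · exact .inl h
    · refine .inr ?_
      have : ‖((ContinuousLinearEquiv.refl ℝ E).symm : E →L[ℝ] E)‖₊ = 1 :=
        NNReal.eq ContinuousLinearMap.norm_id
      rw [this, inv_one]
      exact hc
  let F := happrox.toHomeomorph _ hN
  have hF : ∀ x, F x = x + w x := fun _ => rfl
  have hFs : ContDiff ℝ ∞ F := contDiff_id.add hw
  have hnorm : ∀ x, ‖-fderiv ℝ w x‖ < 1 := fun x => by
    rw [norm_neg]
    exact (norm_fderiv_le_of_lipschitz ℝ hwc).trans_lt hc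
  let F' : E → E ≃L[ℝ] E := fun x =>
    ContinuousLinearEquiv.unitsEquiv ℝ E (Units.oneSub _ (hnorm x))
  have hF' : ∀ x, HasFDerivAt F (F' x : E →L[ℝ] E) x := fun x => by
    have h1 : HasFDerivAt F (ContinuousLinearMap.id ℝ E + fderiv ℝ w x) x :=
      (hasFDerivAt_id x).add ((hw.differentiable (by simp)) x).hasFDerivAt
    convert h1 using 1
    ext y
    simp [F']
  exact ⟨⟨F.toEquiv, hFs.contMDiff, (F.contDiff_symm hF' hFs).contMDiff⟩, hF⟩

variable [FiniteDimensional ℝ E] [HasContDiffBump E]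

/-- The germ at `0` of a smooth map that is tangent to the identity is the germ of a
diffeomorphism which is the identity outside a ball. -/
theorem exists_diffeomorph_eventuallyEq {u : E → E} (hu : ContDiff ℝ ∞ u) (hu₀ : u 0 = 0)
    (hdu : HasFDerivAt u (ContinuousLinearMap.id ℝ E) 0) :
    ∃ (F : E ≃ₘ⟮𝓘(ℝ, E), 𝓘(ℝ, E)⟯ E) (R : ℝ), (∀ᶠ x in 𝓝 0, F x = u x) ∧
      ∀ x, R ≤ ‖x‖ → F x = x := by
  let χ : ContDiffBump (0 : E) := ⟨1, 2, one_pos, one_lt_two⟩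
  obtain ⟨C, hC⟩ := (χ.contDiff (n := 1)).lipschitzWith_of_hasCompactSupport
    χ.hasCompactSupport (by norm_num)
  -- With this constant, the perturbation below is Lipschitz with constant `1 / 2`.
  let η : NNReal := (2 * (1 + 2 * C))⁻¹
  have hη : 0 < η := by positivity
  have hstrict : HasStrictFDerivAt u (ContinuousLinearMap.id ℝ E) 0 := by
    have := hu.contDiffAt.hasStrictFDerivAt (x := 0) (by simp)
    rwa [hdu.fderiv] at this
  obtain ⟨s, hs, hsu⟩ := hstrict.approximates_deriv_on_nhds (c := η) (.inr hη)
  rw [ApproximatesLinearOn.approximatesLinearOn_iff_lipschitzOnWith] at hsu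
  obtain ⟨r, hr, hrs⟩ := Metric.mem_nhds_iff.1 hs
  obtain ⟨δ, hδ, hδr⟩ : ∃ δ : ℝ, 0 < δ ∧ 2 * δ < r := ⟨r / 3, by positivity, by linarith⟩
  let q : E → E := fun x => u x - x
  have hq : ∀ x y, ‖x‖ ≤ 2 * δ → ‖y‖ ≤ 2 * δ → ‖q x - q y‖ ≤ η * ‖x - y‖ := by
    intro x y hx hy
    have h1 := hsu.norm_sub_le (hrs (mem_ball_zero_iff.2 (hx.trans_lt hδr)))
      (hrs (mem_ball_zero_iff.2 (hy.trans_lt hδr)))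
    simpa using h1
  have hq' : ∀ x, ‖x‖ ≤ 2 * δ → ‖q x‖ ≤ η * (2 * δ) := by
    intro x hx
    have h1 := hq x 0 hx (by simpa using hδ.le)
    simp only [q, hu₀, sub_zero] at h1 ⊢
    exact h1.trans (by gcongr)
  let ψ : E → ℝ := fun x => χ (δ⁻¹ • x)
  have hψ0 : ∀ x, 2 * δ ≤ ‖x‖ → ψ x = 0 := by
    intro x hx
    refine χ.zero_of_le_dist ?_
    rw [dist_zero_right, norm_smul, Real.norm_of_nonneg (by positivity)]
    change 2 ≤ _
    rw [← div_eq_inv_mul, le_div_iff₀ hδ]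
    exact hx
  have hψ1 : ∀ x, |ψ x| ≤ 1 := fun x => by
    rw [abs_of_nonneg χ.nonneg]
    exact χ.le_one
  have hψL : ∀ x y, |ψ x - ψ y| ≤ C * (δ⁻¹ * ‖x - y‖) := by
    intro x y
    have h1 := hC.norm_sub_le (δ⁻¹ • x) (δ⁻¹ • y)
    rwa [← smul_sub, norm_smul, Real.norm_of_nonneg (show 0 ≤ δ⁻¹ by positivity)] at h1
  let w : E → E := fun x => ψ x • q x
  have hw : ContDiff ℝ ∞ w :=
    ContDiff.smul (χ.contDiff.comp (contDiff_const_smul _)) (hu.sub contDiff_id)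
  have hcut : ∀ x y, ‖y‖ ≤ 2 * δ → ‖(ψ x - ψ y) • q y‖ ≤ 2 * C * η * ‖x - y‖ := by
    intro x y hy
    rw [norm_smul]
    calc ‖ψ x - ψ y‖ * ‖q y‖ ≤ (C * (δ⁻¹ * ‖x - y‖)) * (η * (2 * δ)) := by
          gcongr
          · exact hψL x y
          · exact hq' y hy
      _ = 2 * C * η * ‖x - y‖ := by
          field_simp
  have hsum : (η : ℝ) + 2 * C * η = 1 / 2 := by
    have : (η : ℝ) = (2 * (1 + 2 * (C : ℝ)))⁻¹ := by simp [η]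
    rw [this]
    have : (0 : ℝ) < 1 + 2 * C := by positivity
    field_simp
  have hηC : (0 : ℝ) ≤ 2 * C * η := by positivity
  have hwL : LipschitzWith (1 / 2) w := by
    refine LipschitzWith.of_dist_le_mul fun x y => ?_
    rw [dist_eq_norm, dist_eq_norm]
    change ‖ψ x • q x - ψ y • q y‖ ≤ ((1 / 2 : NNReal) : ℝ) * ‖x - y‖
    have h2 : ((1 / 2 : NNReal) : ℝ) = η + 2 * C * η := by rw [hsum]; simp
    rw [h2, add_mul]
    have hx0 : 0 ≤ (η : ℝ) * ‖x - y‖ := by positivity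
    have h3 : 0 ≤ 2 * C * η * ‖x - y‖ := by positivity
    rcases le_or_gt ‖y‖ (2 * δ) with hy | hy
    · rcases le_or_gt ‖x‖ (2 * δ) with hx | hx
      · have : ψ x • q x - ψ y • q y = ψ x • (q x - q y) + (ψ x - ψ y) • q y := by module
        rw [this]
        refine (norm_add_le _ _).trans (add_le_add ?_ (hcut x y hy))
        rw [norm_smul]
        calc ‖ψ x‖ * ‖q x - q y‖ ≤ 1 * (η * ‖x - y‖) := by
              gcongr
              · exact hψ1 x
              · exact hq x y hx hy
          _ = _ := one_mul _
      · have : ψ x • q x - ψ y • q y = (ψ x - ψ y) • q y := by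
          rw [hψ0 x hx.le]
          module
        rw [this]
        linarith [hcut x y hy]
    · rcases le_or_gt ‖x‖ (2 * δ) with hx | hx
      · have : ψ x • q x - ψ y • q y = -((ψ y - ψ x) • q x) := by
          rw [hψ0 y hy.le]
          module
        rw [this, norm_neg]
        have := hcut y x hx
        rw [norm_sub_rev y x] at this
        linarith
      · rw [hψ0 x hx.le, hψ0 y hy.le, zero_smul, zero_smul, sub_zero, norm_zero]
        linarith
  obtain ⟨F, hF⟩ := exists_diffeomorph_id_add hw
    (show (1 / 2 : NNReal) < 1 from NNReal.half_lt_self one_ne_zero) hwL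
  refine ⟨F, 2 * δ, ?_, fun x hx => ?_⟩
  · filter_upwards [Metric.ball_mem_nhds (0 : E) hδ] with x hx
    have h1 : ψ x = 1 := by
      refine χ.one_of_mem_closedBall ?_
      rw [mem_closedBall_zero_iff, norm_smul, Real.norm_of_nonneg (by positivity)]
      change _ ≤ 1
      rw [← div_eq_inv_mul, div_le_one hδ]
      exact (mem_ball_zero_iff.1 hx).le
    simp [hF, w, h1, q]
  · simp [hF, w, hψ0 x hx]

end Germ

section DiscExtension

variable {n : ℕ} {M : Type*} [TopologicalSpace M] [ChartedSpace (Euc n) M]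
  {i : PartialDiffeomorph (𝓡 n) (𝓡 n) (Euc n) M ∞}
  {F H N : Type*} [NormedAddCommGroup F] [NormedSpace ℝ F] [TopologicalSpace H]
  {J : ModelWithCorners ℝ F H}

open Classical in
/-- The map that is `f` on the disc `i` and `g` outside it. -/
noncomputable def discExtend (i : PartialDiffeomorph (𝓡 n) (𝓡 n) (Euc n) M ∞) (f : Euc n → N)
    (g : M → N) (x : M) : N :=
  if x ∈ i.target then f (i.symm x) else g x

theorem discExtend_apply (hi : i.source = univ) (f : Euc n → N) (g : M → N) (v : Euc n) :
    discExtend i f g (i v) = f v := by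
  rw [discExtend, if_pos (i.map_source (by simp [hi])),
    PartialDiffeomorph.left_inv_of_source_univ hi]

theorem discExtend_of_notMem (f : Euc n → N) (g : M → N) {x : M} (hx : x ∉ i.target) :
    discExtend i f g x = g x :=
  if_neg hx

variable [T2Space M] [TopologicalSpace N] [ChartedSpace H N]

theorem contMDiff_discExtend (hi : i.source = univ) {f : Euc n → N} {g : M → N}
    (hf : ContMDiff (𝓡 n) J ∞ f) (hg : ContMDiff (𝓡 n) J ∞ g) {R : ℝ}
    (hfg : ∀ v, R ≤ ‖v‖ → f v = g (i v)) : ContMDiff (𝓡 n) J ∞ (discExtend i f g) := by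
  intro x
  by_cases hx : x ∈ i.target
  · refine ((hf.comp_contMDiffOn i.symm.contMDiffOn).contMDiffAt
      (i.open_target.mem_nhds hx)).congr_of_eventuallyEq ?_
    filter_upwards [i.open_target.mem_nhds hx] with y hy
    exact if_pos hy
  · -- The image of the closed ball of radius `R` is compact, hence closed, as `M` is Hausdorff.
    have hc : IsClosed (i '' closedBall 0 R) :=
      ((isCompact_closedBall _ _).image
        (PartialDiffeomorph.contMDiff_of_source_univ hi).continuous).isClosed
    have hx' : x ∈ (i '' closedBall 0 R)ᶜ := by
      rintro ⟨v, -, rfl⟩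
      exact hx (i.map_source (by simp [hi]))
    refine hg.contMDiffAt.congr_of_eventuallyEq ?_
    filter_upwards [hc.isOpen_compl.mem_nhds hx'] with y hy
    by_cases hyt : y ∈ i.target
    · rw [PartialDiffeomorph.target_eq_range hi] at hyt
      obtain ⟨v, rfl⟩ := hyt
      rw [discExtend_apply hi]
      refine hfg v (le_of_not_gt fun hv => hy ⟨v, ?_, rfl⟩)
      simpa using hv.le
    · exact if_neg hyt

/-- A diffeomorphism of `ℝ^n` that is the identity outside a ball, transported to `M` by the
disc `i` and extended by the identity. -/
theorem exists_diffeomorph_of_disc (hi : i.source = univ)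
    (F : Euc n ≃ₘ⟮𝓡 n, 𝓡 n⟯ Euc n) {R : ℝ} (hF : ∀ v, R ≤ ‖v‖ → F v = v) :
    ∃ Ψ : M ≃ₘ⟮𝓡 n, 𝓡 n⟯ M, ∀ v, Ψ (i v) = i (F v) := by
  have hi' := PartialDiffeomorph.contMDiff_of_source_univ hi
  have hF' : ∀ v, R ≤ ‖v‖ → F.symm v = v := fun v hv => by
    rw [← hF v hv, F.symm_apply_apply, hF v hv]
  have key : ∀ (f g : Euc n → Euc n), (∀ v, g (f v) = v) →
      ∀ x : M, discExtend i (i ∘ g) id (discExtend i (i ∘ f) id x) = x := by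
    intro f g hfg x
    by_cases hx : x ∈ i.target
    · rw [PartialDiffeomorph.target_eq_range hi] at hx
      obtain ⟨v, rfl⟩ := hx
      rw [discExtend_apply hi, Function.comp_apply, discExtend_apply hi, Function.comp_apply, hfg]
    · rw [discExtend_of_notMem _ _ hx, id, discExtend_of_notMem _ _ hx, id]
  exact ⟨{
    toFun := discExtend i (i ∘ F) id
    invFun := discExtend i (i ∘ F.symm) id
    left_inv := key F F.symm F.symm_apply_apply
    right_inv := key F.symm F F.apply_symm_apply
    contMDiff_toFun := contMDiff_discExtend hi (hi'.comp F.contMDiff) contMDiff_id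
      fun v hv => congrArg i (hF v hv)
    contMDiff_invFun := contMDiff_discExtend hi (hi'.comp F.symm.contMDiff) contMDiff_id
      fun v hv => congrArg i (hF' v hv) }, fun v => discExtend_apply hi _ _ v⟩

end DiscExtension

/-! ### Averaging over a compact Lie group -/

section ParametricIntegral

open MeasureTheory

universe w

variable {k : ℕ} {G : Type v} [TopologicalSpace G] [ChartedSpace (Euc k) G] [IsManifold (𝓡 k) ∞ G]
  {E : Type w} [NormedAddCommGroup E] [NormedSpace ℝ E]

theorem contMDiff_partial_fderiv {V : Type w} [NormedAddCommGroup V] [NormedSpace ℝ V]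
    {f : G → E → V}
    (hf : ContMDiff ((𝓡 k).prod 𝓘(ℝ, E)) 𝓘(ℝ, V) ∞ fun z : G × E => f z.1 z.2) :
    ContMDiff ((𝓡 k).prod 𝓘(ℝ, E)) 𝓘(ℝ, E →L[ℝ] V) ∞
      fun z : G × E => fderiv ℝ (f z.1) z.2 := by
  intro z
  have h1 : ContMDiffAt (((𝓡 k).prod 𝓘(ℝ, E)).prod 𝓘(ℝ, E)) 𝓘(ℝ, V) ∞
      (Function.uncurry fun (z : G × E) (y : E) => f z.1 y) (z, z.2) :=
    (hf.comp (contMDiff_fst.fst.prodMk contMDiff_snd)).contMDiffAt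
  have h2 := ContMDiffAt.mfderiv (m := ∞) (fun (z : G × E) (y : E) => f z.1 y) Prod.snd h1
    contMDiffAt_snd (by simp)
  have h3 : (fun x : G × E => mfderiv 𝓘(ℝ, E) 𝓘(ℝ, V) (f x.1) x.2) =
      fun x => fderiv ℝ (f x.1) x.2 := funext fun _ => mfderiv_eq_fderiv
  have h4 := inTangentCoordinates_model_space (I := 𝓘(ℝ, E)) (I' := 𝓘(ℝ, V)) Prod.snd
    (fun x : G × E => f x.1 x.2) (fun x => fderiv ℝ (f x.1) x.2) z
  exact (congrArg (fun ϕ => inTangentCoordinates 𝓘(ℝ, E) 𝓘(ℝ, V) Prod.snd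
    (fun x : G × E => f x.1 x.2) ϕ z) h3).trans h4 ▸ h2

variable [CompactSpace G] [SecondCountableTopology G] [MeasurableSpace G] [BorelSpace G]
  {μ : Measure G} [IsFiniteMeasure μ] [FiniteDimensional ℝ E]

theorem hasFDerivAt_integral_of_contMDiff {V : Type w} [NormedAddCommGroup V] [NormedSpace ℝ V]
    {f : G → E → V}
    (hf : ContMDiff ((𝓡 k).prod 𝓘(ℝ, E)) 𝓘(ℝ, V) ∞ fun z : G × E => f z.1 z.2) (x : E) :
    HasFDerivAt (fun x => ∫ g, f g x ∂μ) (∫ g, fderiv ℝ (f g) x ∂μ) x := by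
  have hc : Continuous fun z : G × E => f z.1 z.2 := hf.continuous
  have hd : Continuous fun z : G × E => fderiv ℝ (f z.1) z.2 :=
    (contMDiff_partial_fderiv hf).continuous
  obtain ⟨C, hC⟩ := ((isCompact_univ (X := G)).prod (isCompact_closedBall x 1)).bddAbove_image
    hd.norm.continuousOn
  have hcx : ∀ y, Continuous fun g => f g y := fun y =>
    hc.comp (Continuous.prodMk_left y)
  have hdx : Continuous fun g => fderiv ℝ (f g) x :=
    hd.comp (Continuous.prodMk_left x)
  have hsmooth : ∀ g, ContDiff ℝ ∞ (f g) := fun g =>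
    (hf.comp (contMDiff_const.prodMk contMDiff_id)).contDiff
  refine hasFDerivAt_integral_of_dominated_of_fderiv_le (bound := fun _ => C)
    (closedBall_mem_nhds x one_pos)
    (.of_forall fun y => (hcx y).aestronglyMeasurable) ?_ hdx.aestronglyMeasurable
    (.of_forall fun g y hy => hC ⟨(g, y), ⟨mem_univ _, hy⟩, rfl⟩) (integrable_const _)
    (.of_forall fun g y _ => ((hsmooth g).differentiable (by simp) y).hasFDerivAt)
  exact (hcx x).integrable_of_hasCompactSupport (HasCompactSupport.of_compactSpace _)

theorem contDiff_integral_of_contMDiff {V : Type w} [NormedAddCommGroup V] [NormedSpace ℝ V]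
    {f : G → E → V}
    (hf : ContMDiff ((𝓡 k).prod 𝓘(ℝ, E)) 𝓘(ℝ, V) ∞ fun z : G × E => f z.1 z.2) :
    ContDiff ℝ ∞ fun x => ∫ g, f g x ∂μ := by
  have key : ∀ (n : ℕ) (V : Type w) [NormedAddCommGroup V] [NormedSpace ℝ V] (f : G → E → V),
      ContMDiff ((𝓡 k).prod 𝓘(ℝ, E)) 𝓘(ℝ, V) ∞ (fun z : G × E => f z.1 z.2) →
      ContDiff ℝ n fun x => ∫ g, f g x ∂μ := by
    intro n
    induction n with
    | zero =>
      intro V _ _ f hf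
      refine contDiff_zero.2 ?_
      exact continuous_iff_continuousAt.2 fun x =>
        (hasFDerivAt_integral_of_contMDiff hf x).continuousAt
    | succ n ih =>
      intro V _ _ f hf
      rw [Nat.cast_succ]
      refine contDiff_succ_iff_fderiv.2 ⟨fun x =>
        (hasFDerivAt_integral_of_contMDiff hf x).differentiableAt, by simp, ?_⟩
      have h1 : fderiv ℝ (fun x => ∫ g, f g x ∂μ) = fun x => ∫ g, fderiv ℝ (f g) x ∂μ :=
        funext fun x => (hasFDerivAt_integral_of_contMDiff hf x).fderiv
      rw [h1]
      exact ih (E →L[ℝ] V) (fun g x => fderiv ℝ (f g) x) (contMDiff_partial_fderiv hf)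
  exact contDiff_infty.2 fun n => key n V f hf

end ParametricIntegral

section Averaging

variable {m k : ℕ} {G : Type v} [Group G] [TopologicalSpace G] [CompactSpace G]
  [ChartedSpace (Euc k) G] [LieGroup (𝓡 k) ∞ G]
  {M : Type u} [TopologicalSpace M] [T2Space M]
  [ChartedSpace (Euc (m + 1)) M]
  [MulAction G M] [ContMDiffSMul (𝓡 k) (𝓡 (m + 1)) ∞ G M]

open MeasureTheory in
/-- The average `∫ ρ(g) ψ(g⁻¹ x) dg`, for a function `ψ` that inverts the disc `i` near the fixed
point `i 0`: it is an equivariant map to the isotropy representation, and in the coordinates of `i`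
it is smooth and tangent to the identity. -/
theorem exists_equivariant_map
    {i : PartialDiffeomorph (𝓡 (m + 1)) (𝓡 (m + 1)) (Euc (m + 1)) M ∞} (hi : i.source = univ)
    (hp : ∀ g : G, g • i 0 = i 0)
    (ρ : G →* (Euc (m + 1) ≃ₗᵢ[ℝ] Euc (m + 1)))
    (hρ : ContMDiff ((𝓡 k).prod (𝓡 (m + 1))) (𝓡 (m + 1)) ∞
      fun z : G × Euc (m + 1) => ρ z.1 z.2)
    (hL : ∀ (g : G) (v : Euc (m + 1)),
      mfderiv (𝓡 (m + 1)) (𝓡 (m + 1)) (fun x : M => g • x) (i 0)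
        (mfderiv (𝓡 (m + 1)) (𝓡 (m + 1)) i (0 : Euc (m + 1)) v) =
      mfderiv (𝓡 (m + 1)) (𝓡 (m + 1)) i (0 : Euc (m + 1)) (ρ g v)) :
    ∃ A : M → Euc (m + 1), (∀ (g : G) x, A (g • x) = ρ g (A x)) ∧
      ContDiff ℝ ∞ (fun v => A (i v)) ∧ A (i 0) = 0 ∧
      HasFDerivAt (fun v => A (i v)) (ContinuousLinearMap.id ℝ (Euc (m + 1))) 0 := by
  have : IsTopologicalGroup G := topologicalGroup_of_lieGroup (𝓡 k) ∞
  have : SecondCountableTopology G := ChartedSpace.secondCountable_of_sigmaCompact (Euc k) G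
  let _ : MeasurableSpace G := borel G
  have : BorelSpace G := ⟨rfl⟩
  let K : PositiveCompacts G := ⊤
  let μ : Measure G := Measure.haarMeasure K
  have hμ : μ univ = 1 := Measure.haarMeasure_self (K₀ := K)
  have : IsProbabilityMeasure μ := ⟨hμ⟩
  have hi' := PartialDiffeomorph.contMDiff_of_source_univ hi
  -- A smooth function on `M` that inverts `i` near `i 0`.
  let χ : ContDiffBump (0 : Euc (m + 1)) := ⟨1, 2, one_pos, one_lt_two⟩
  let ψ : M → Euc (m + 1) := discExtend i (fun v => χ v • v) fun _ => 0
  have hψ : ContMDiff (𝓡 (m + 1)) (𝓡 (m + 1)) ∞ ψ := by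
    refine contMDiff_discExtend hi (χ.contDiff.smul contDiff_id).contMDiff contMDiff_const
      (R := 2) fun v hv => ?_
    rw [χ.zero_of_le_dist (by simpa using hv), zero_smul]
  have hψi : (fun v => ψ (i v)) =ᶠ[𝓝 0] id := by
    filter_upwards [closedBall_mem_nhds (0 : Euc (m + 1)) one_pos] with v hv
    change discExtend i _ _ (i v) = v
    rw [discExtend_apply hi, χ.one_of_mem_closedBall hv, one_smul]
  have hψ0 : ψ (i 0) = 0 := hψi.eq_of_nhds
  have hact : ∀ g : G, ContMDiff (𝓡 (m + 1)) (𝓡 (m + 1)) ∞ fun x : M => g • x :=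
    fun g => ContMDiffSMul.contMDiff_const_smul (I := 𝓡 k) g
  have hF : ContMDiff ((𝓡 k).prod 𝓘(ℝ, Euc (m + 1))) 𝓘(ℝ, Euc (m + 1)) ∞
      fun z : G × Euc (m + 1) => ρ z.1 (ψ (z.1⁻¹ • i z.2)) :=
    hρ.comp (contMDiff_fst.prodMk (hψ.comp
      ((contMDiff_smul (I := 𝓡 k) (I' := 𝓡 (m + 1)) (n := ∞) (G := G) (M := M)).comp
        (contMDiff_fst.inv.prodMk (hi'.comp contMDiff_snd)))))
  -- Each of the averaged functions is tangent to the identity, by the choice of `ρ`.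
  have hderiv : ∀ g : G, HasFDerivAt (fun v => ρ g (ψ (g⁻¹ • i v)))
      (ContinuousLinearMap.id ℝ (Euc (m + 1))) 0 := by
    intro g
    have d1 := (hi' 0).mdifferentiableAt (by simp) |>.hasMFDerivAt
    have d2 := (hact g⁻¹ (i 0)).mdifferentiableAt (by simp) |>.hasMFDerivAt
    have d3 := (hψ (i 0)).mdifferentiableAt (by simp) |>.hasMFDerivAt
    have d4 : HasMFDerivAt (𝓡 (m + 1)) (𝓡 (m + 1)) ψ (g⁻¹ • i 0)
        (mfderiv (𝓡 (m + 1)) (𝓡 (m + 1)) ψ (i 0) : Euc (m + 1) →L[ℝ] Euc (m + 1)) :=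
      (hp g⁻¹).symm ▸ d3
    have e1 : ∀ v : Euc (m + 1), mfderiv (𝓡 (m + 1)) (𝓡 (m + 1)) ψ (i 0)
        (mfderiv (𝓡 (m + 1)) (𝓡 (m + 1)) i (0 : Euc (m + 1)) v) = v := by
      intro v
      let D₁ : Euc (m + 1) →L[ℝ] Euc (m + 1) := mfderiv (𝓡 (m + 1)) (𝓡 (m + 1)) i 0
      let D₃ : Euc (m + 1) →L[ℝ] Euc (m + 1) := mfderiv (𝓡 (m + 1)) (𝓡 (m + 1)) ψ (i 0)
      have h1 : HasFDerivAt (fun v => ψ (i v)) (D₃.comp D₁) 0 :=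
        (d3.comp (0 : Euc (m + 1)) d1).hasFDerivAt
      have h2 := (hasFDerivAt_id (𝕜 := ℝ) (0 : Euc (m + 1))).congr_of_eventuallyEq hψi
      exact congrArg (fun T : Euc (m + 1) →L[ℝ] Euc (m + 1) => T v) (h1.unique h2)
    have h3 := (d4.comp (0 : Euc (m + 1)) (d2.comp (0 : Euc (m + 1)) d1)).hasFDerivAt
    have hd : HasFDerivAt (ρ g) ((ρ g).toContinuousLinearEquiv : Euc (m + 1) →L[ℝ] Euc (m + 1))
        (ψ (g⁻¹ • i 0)) := (ρ g).toContinuousLinearEquiv.hasFDerivAt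
    have h4 := hd.comp (0 : Euc (m + 1)) h3
    refine h4.congr_fderiv (ContinuousLinearMap.ext fun v => ?_)
    have h5 : mfderiv (𝓡 (m + 1)) (𝓡 (m + 1)) ψ (i 0)
      (mfderiv (𝓡 (m + 1)) (𝓡 (m + 1)) (fun x : M => g⁻¹ • x) (i 0)
        (mfderiv (𝓡 (m + 1)) (𝓡 (m + 1)) i (0 : Euc (m + 1)) v)) = ρ g⁻¹ v :=
      (congrArg (mfderiv (𝓡 (m + 1)) (𝓡 (m + 1)) ψ (i 0)) (hL g⁻¹ v)).trans (e1 (ρ g⁻¹ v))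
    exact (congrArg (ρ g) h5).trans (by simp)
  refine ⟨fun x => ∫ g, ρ g (ψ (g⁻¹ • x)) ∂μ, fun h x => ?_,
    contDiff_integral_of_contMDiff (f := fun g v => ρ g (ψ (g⁻¹ • i v))) hF, ?_, ?_⟩
  · -- Left invariance of the Haar measure: replace `g` by `h g`.
    calc ∫ g, ρ g (ψ (g⁻¹ • h • x)) ∂μ
        = ∫ g, ρ (h * g) (ψ ((h * g)⁻¹ • h • x)) ∂μ :=
          (integral_mul_left_eq_self (fun g => ρ g (ψ (g⁻¹ • h • x))) h).symm
      _ = ∫ g, ((ρ h).toContinuousLinearEquiv : Euc (m + 1) →L[ℝ] Euc (m + 1))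
            (ρ g (ψ (g⁻¹ • x))) ∂μ := by
          refine integral_congr_ae (.of_forall fun g => ?_)
          simp [mul_smul]
      _ = ρ h (∫ g, ρ g (ψ (g⁻¹ • x)) ∂μ) :=
          (ρ h).toContinuousLinearEquiv.integral_comp_comm _
  · simp [hp, hψ0]
  · refine (hasFDerivAt_integral_of_contMDiff (μ := μ)
      (f := fun g v => ρ g (ψ (g⁻¹ • i v))) hF 0).congr_fderiv ?_
    simp [(hderiv _).fderiv]

end Averaging

/-! ### Equivariant discs -/

section Linearization

variable {m k : ℕ} {G : Type v} [Group G] [TopologicalSpace G] [CompactSpace G]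
  [ChartedSpace (Euc k) G] [LieGroup (𝓡 k) ∞ G]
  {M : Type u} [TopologicalSpace M] [T2Space M]
  [ChartedSpace (Euc (m + 1)) M]
  [MulAction G M] [ContMDiffSMul (𝓡 k) (𝓡 (m + 1)) ∞ G M]

/-- If the derivative of the disc `i` at `0` intertwines `ρ` with the isotropy representation, then
some diffeomorphism `Ψ⁻¹` of `M` moves `i` to a disc that is equivariant near its centre. -/
theorem exists_diffeomorph_equivariant_near
    {i : PartialDiffeomorph (𝓡 (m + 1)) (𝓡 (m + 1)) (Euc (m + 1)) M ∞} (hi : i.source = univ)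
    (hp : ∀ g : G, g • i 0 = i 0)
    (ρ : G →* (Euc (m + 1) ≃ₗᵢ[ℝ] Euc (m + 1)))
    (hρ : ContMDiff ((𝓡 k).prod (𝓡 (m + 1))) (𝓡 (m + 1)) ∞
      fun z : G × Euc (m + 1) => ρ z.1 z.2)
    (hL : ∀ (g : G) (v : Euc (m + 1)),
      mfderiv (𝓡 (m + 1)) (𝓡 (m + 1)) (fun x : M => g • x) (i 0)
        (mfderiv (𝓡 (m + 1)) (𝓡 (m + 1)) i (0 : Euc (m + 1)) v) =
      mfderiv (𝓡 (m + 1)) (𝓡 (m + 1)) i (0 : Euc (m + 1)) (ρ g v)) :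
    ∃ Ψ : M ≃ₘ⟮𝓡 (m + 1), 𝓡 (m + 1)⟯ M, Ψ (i 0) = i 0 ∧ ∃ ε > 0,
      ∀ v : Euc (m + 1), ‖v‖ < ε → ∀ g : G, g • Ψ.symm (i v) = Ψ.symm (i (ρ g v)) := by
  obtain ⟨A, hAG, hAs, hA0, hdA⟩ := exists_equivariant_map hi hp ρ hρ hL
  obtain ⟨F, R, hFA, hFR⟩ := exists_diffeomorph_eventuallyEq hAs hA0 hdA
  obtain ⟨Ψ, hΨ⟩ := exists_diffeomorph_of_disc hi F hFR
  have hF0 : F 0 = 0 := hFA.self_of_nhds.trans hA0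
  have hF0' : F.symm 0 = 0 := by rw [← hF0, F.symm_apply_apply, hF0]
  have hΨ' : ∀ v, Ψ.symm (i v) = i (F.symm v) := fun v => by
    rw [← Ψ.symm_apply_apply (i (F.symm v)), hΨ, F.apply_symm_apply]
  refine ⟨Ψ, by rw [hΨ, hF0], ?_⟩
  obtain ⟨s, hs, hso, h0s⟩ := _root_.eventually_nhds_iff.1 hFA
  have hiE := PartialDiffeomorph.isOpenEmbedding_of_source_univ hi
  have hV : IsOpen (i '' s) := hiE.isOpenMap s hso
  have hsmul : Continuous fun z : M × G => z.2 • z.1 :=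
    (contMDiff_smul (I := 𝓡 k) (I' := 𝓡 (m + 1)) (n := ∞) (G := G) (M := M)).continuous.comp
      continuous_swap
  -- As `G` is compact, near the fixed point all translates stay where `A ∘ i = F`.
  have hG : ∀ᶠ x in 𝓝 (i 0), ∀ g ∈ (univ : Set G), g • x ∈ i '' s := by
    refine isCompact_univ.eventually_forall_of_forall_eventually fun g _ => ?_
    exact (hV.preimage hsmul).mem_nhds (show g • i 0 ∈ i '' s by
      rw [hp]
      exact mem_image_of_mem _ h0s)
  have hcont : ContinuousAt (fun v => i (F.symm v)) 0 :=
    (hiE.continuous.comp F.symm.continuous).continuousAt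
  have hG' : ∀ᶠ v in 𝓝 (0 : Euc (m + 1)), ∀ g : G, g • i (F.symm v) ∈ i '' s := by
    have h1 : ∀ᶠ x in 𝓝 ((fun v => i (F.symm v)) 0), ∀ g ∈ (univ : Set G), g • x ∈ i '' s := by
      simpa only [hF0'] using hG
    filter_upwards [hcont.eventually h1] with v hv g using hv g (mem_univ g)
  obtain ⟨ε, hε, hball⟩ := Metric.eventually_nhds_iff.1 hG'
  refine ⟨ε, hε, fun v hv g => ?_⟩
  have h2 := hball (y := v) (by simpa using hv)
  have hAv : A (i (F.symm v)) = v := by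
    obtain ⟨w, hws, hw⟩ := h2 1
    rw [one_smul] at hw
    rw [← hw, ← hs w hws, hiE.injective hw, F.apply_symm_apply]
  obtain ⟨w, hws, hw⟩ := h2 g
  rw [hΨ', hΨ', ← hw]
  congr 1
  have h3 : F w = ρ g v := by rw [hs w hws, hw, hAG, hAv]
  rw [← h3, F.symm_apply_apply]

end Linearization

section Shrink

variable {m : ℕ}

theorem univBall_zero_apply {ε : ℝ} (hε : 0 < ε) (v : Euc m) :
    OpenPartialHomeomorph.univBall (0 : Euc m) ε v = (ε * (√(1 + ‖v‖ ^ 2))⁻¹) • v := by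
  rw [OpenPartialHomeomorph.univBall, dif_pos hε, mul_smul]
  change ε • ((√(1 + ‖v‖ ^ 2))⁻¹ • v) +ᵥ (0 : Euc m) = _
  simp

/-- The radial diffeomorphism of `ℝ^m` onto the open ball of radius `ε`. -/
noncomputable def radialShrink (m : ℕ) {ε : ℝ} (hε : 0 < ε) :
    PartialDiffeomorph (𝓡 m) (𝓡 m) (Euc m) (Euc m) ∞ where
  toPartialEquiv := (OpenPartialHomeomorph.univBall (0 : Euc m) ε).toPartialEquiv
  open_source := (OpenPartialHomeomorph.univBall (0 : Euc m) ε).open_source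
  open_target := (OpenPartialHomeomorph.univBall (0 : Euc m) ε).open_target
  contMDiffOn_toFun := OpenPartialHomeomorph.contDiff_univBall.contMDiff.contMDiffOn
  contMDiffOn_invFun := by
    rw [contMDiffOn_iff_contDiffOn, OpenPartialHomeomorph.univBall_target _ hε]
    exact OpenPartialHomeomorph.contDiffOn_univBall_symm

theorem radialShrink_source {ε : ℝ} (hε : 0 < ε) : (radialShrink m hε).source = univ :=
  OpenPartialHomeomorph.univBall_source _ _

theorem norm_radialShrink_lt {ε : ℝ} (hε : 0 < ε) (v : Euc m) : ‖radialShrink m hε v‖ < ε := by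
  have h1 := (radialShrink m hε).map_source (x := v) (by simp [radialShrink_source])
  have h2 : (radialShrink m hε).target = ball 0 ε := OpenPartialHomeomorph.univBall_target _ hε
  rw [h2] at h1
  exact mem_ball_zero_iff.1 h1

theorem radialShrink_map {ε : ℝ} (hε : 0 < ε) (T : Euc m ≃ₗᵢ[ℝ] Euc m) (v : Euc m) :
    radialShrink m hε (T v) = T (radialShrink m hε v) := by
  refine (univBall_zero_apply hε (T v)).trans
    (.trans ?_ (congrArg T (univBall_zero_apply hε v)).symm)
  rw [T.norm_map, map_smul]

theorem direction_pos_smul {t : ℝ} (ht : 0 < t) (v : Euc (m + 1)) :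
    direction (t • v) = direction v := by
  rcases eq_or_ne v 0 with rfl | hv
  · rw [smul_zero]
  · have h1 : v = ‖v‖ • (direction v : Euc (m + 1)) := by
      rw [coe_direction hv, smul_smul, mul_inv_cancel₀ (norm_ne_zero_iff.2 hv), one_smul]
    rw [h1, smul_smul, direction_smul (by positivity), direction_smul (norm_pos_iff.2 hv)]

theorem direction_radialShrink {ε : ℝ} (hε : 0 < ε) (v : Euc (m + 1)) :
    direction (radialShrink (m + 1) hε v) = direction v := by
  refine (congrArg direction (univBall_zero_apply hε v)).trans (direction_pos_smul ?_ v)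
  positivity

end Shrink

/-! ### The connected sum with a twisted sphere -/

section ConnectedSumTwisted

variable {m : ℕ} {M : Type u} [TopologicalSpace M]
  [ChartedSpace (Euc (m + 1)) M]

theorem mem_puncture {i : SmoothDisc (m + 1) M} {x : M} :
    x ∈ i.puncture ↔ x ≠ i.toPartialDiffeomorph 0 := Iff.rfl

theorem connectedSumGluing_mem {N : Type v} [TopologicalSpace N] [ChartedSpace (Euc (m + 1)) N]
    (i : SmoothDisc (m + 1) M) (j : SmoothDisc (m + 1) N) (x : i.puncture) :
    x ∈ (connectedSumGluing i j).source ↔ (x : M) ∈ i.target := by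
  constructor
  · exact fun hx => hx.2.1
  · intro hx
    have h0 : i.toPartialDiffeomorph.symm (x : M) ≠ 0 := by
      intro h
      have h1 : i.toPartialDiffeomorph (i.toPartialDiffeomorph.symm x) = x := i.right_inv hx
      rw [h] at h1
      exact mem_puncture.1 x.2 h1.symm
    have h2 := (collarGluing (Diffeomorph.refl (𝓡 m) (UnitSphere m) ∞)).map_source
      (show _ ∈ ({0}ᶜ : Set (Euc (m + 1))) from h0)
    refine ⟨mem_univ _, hx, h0, by simp [j.source_eq_univ], ?_⟩
    change _ ∈ (inclusionDiffeo (m := m) j.puncture).target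
    rw [inclusionDiffeo_target]
    refine mem_puncture.2 fun h3 => ?_
    exact h2 (j.injOn (by simp [j.source_eq_univ]) (by simp [j.source_eq_univ]) h3)

theorem coe_connectedSumGluing {N : Type v} [TopologicalSpace N] [ChartedSpace (Euc (m + 1)) N]
    (i : SmoothDisc (m + 1) M) (j : SmoothDisc (m + 1) N) {x : i.puncture}
    (hx : (x : M) ∈ i.target) :
    (connectedSumGluing i j x : N) = j.toPartialDiffeomorph
      (‖i.toPartialDiffeomorph.symm x‖⁻¹ • (direction (i.toPartialDiffeomorph.symm x)).1) := by
  have h1 := ((connectedSumGluing_mem i j x).2 hx).2.2.2.2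
  change _ ∈ (inclusionDiffeo (m := m) j.puncture).target at h1
  rw [inclusionDiffeo_target] at h1
  exact coe_inclusionDiffeo_symm (m := m) j.puncture h1

variable (f : UnitSphere m ≃ₘ⟮𝓡 m, 𝓡 m⟯ UnitSphere m)

theorem inl_mem_puncture_secondDisc (v : Euc (m + 1)) :
    Glue.inl (collarGluing f) v ∈ (TwistedSphere.secondDisc f).puncture := by
  refine mem_puncture.2 fun h => ?_
  obtain ⟨h1, h2⟩ := (Glue.inl_eq_inr (collarGluing f)).1 h
  exact (collarGluing f).map_source h1 h2

theorem mem_range_inl_of_mem_puncture {s : TwistedSphere f}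
    (hs : s ∈ (TwistedSphere.secondDisc f).puncture) : ∃ v, Glue.inl (collarGluing f) v = s := by
  rcases Glue.exists_rep _ s with h | ⟨y, rfl⟩
  · exact h
  · have hy : y ≠ 0 := by
      rintro rfl
      exact mem_puncture.1 hs rfl
    exact ⟨(collarGluing f).symm y, (Glue.inl_eq_inr _).2
      ⟨(collarGluing f).map_target hy, (collarGluing f).right_inv hy⟩⟩

variable (i : SmoothDisc (m + 1) M) [IsManifold (𝓡 (m + 1)) ∞ M]

/-- The first disc of the twisted sphere, as an open piece of the connected sum. -/
noncomputable def firstDiscDiffeo : PartialDiffeomorph (𝓡 (m + 1)) (𝓡 (m + 1)) (Euc (m + 1))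
    (ConnectedSum i (TwistedSphere.secondDisc f)) ∞ :=
  (Glue.inlDiffeo (collarGluing f)).trans
    ((inclusionDiffeo (TwistedSphere.secondDisc f).puncture).symm.trans (Glue.inrDiffeo _))

theorem firstDiscDiffeo_source : (firstDiscDiffeo f i).source = univ := by
  refine eq_univ_of_forall fun v => ⟨mem_univ _, ?_, mem_univ _⟩
  change _ ∈ (inclusionDiffeo (m := m) (TwistedSphere.secondDisc f).puncture).target
  rw [inclusionDiffeo_target]
  exact inl_mem_puncture_secondDisc f v

theorem firstDiscDiffeo_apply (v : Euc (m + 1)) : firstDiscDiffeo f i v =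
    Glue.inr _ ⟨Glue.inl (collarGluing f) v, inl_mem_puncture_secondDisc f v⟩ :=
  congrArg (Glue.inr _) (Subtype.ext
    (coe_inclusionDiffeo_symm (m := m) _ (inl_mem_puncture_secondDisc f v)))

/-- In `M # Σ`, where `Σ` is the twisted sphere of `f`, the first disc of `Σ` replaces `i`,
by means of the radial extension of `f`. -/
theorem firstDiscDiffeo_eq_inl {v : Euc (m + 1)} {x : i.puncture} :
    firstDiscDiffeo f i v = Glue.inl _ x ↔
      (x : M) = i.toPartialDiffeomorph (‖v‖ • (f (direction v) : Euc (m + 1))) := by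
  have hsource : ∀ w, w ∈ i.source := by simp [i.source_eq_univ]
  rw [firstDiscDiffeo_apply, eq_comm, Glue.inl_eq_inr, connectedSumGluing_mem]
  have hcollar : ∀ w : Euc (m + 1), w ≠ 0 →
      (Glue.inl (collarGluing f) v = Glue.inr _ (‖w‖⁻¹ • (direction w).1) ↔
        w = ‖v‖ • (f (direction v) : Euc (m + 1))) := by
    intro w hw
    have hw0 := norm_pos_iff.2 hw
    rw [Glue.inl_eq_inr]
    constructor
    · rintro ⟨hv, h⟩
      have hv0 : 0 < ‖v‖ := norm_pos_iff.2 hv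
      change ‖v‖⁻¹ • (f (direction v) : Euc (m + 1)) = _ at h
      -- Comparing norms gives `|v| = |w|`; then the directions agree.
      have h1 := congrArg norm h
      simp only [norm_smul, norm_inv, norm_norm, norm_eq_of_mem_sphere, mul_one, inv_inj] at h1
      rw [h1] at h ⊢
      rw [smul_right_injective _ (inv_ne_zero hw0.ne') h, coe_direction hw, smul_smul,
        mul_inv_cancel₀ hw0.ne', one_smul]
    · intro h
      have hv : v ≠ 0 := by
        rintro rfl
        exact hw (by rw [h, norm_zero, zero_smul])
      have hv0 : 0 < ‖v‖ := norm_pos_iff.2 hv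
      refine ⟨hv, ?_⟩
      change ‖v‖⁻¹ • (f (direction v) : Euc (m + 1)) = _
      rw [h, direction_smul hv0, norm_smul, norm_norm, norm_eq_of_mem_sphere, mul_one]
  constructor
  · rintro ⟨hx, h⟩
    have h1 := (coe_connectedSumGluing i (TwistedSphere.secondDisc f) hx).symm.trans
      (congrArg Subtype.val h)
    have hw : i.toPartialDiffeomorph (i.toPartialDiffeomorph.symm x) = x := i.right_inv hx
    have h0 : i.toPartialDiffeomorph.symm (x : M) ≠ 0 := by
      intro h
      rw [h] at hw
      exact mem_puncture.1 x.2 hw.symm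
    rw [← (hcollar _ h0).1 h1.symm, hw]
  · intro hx
    have hxt : (x : M) ∈ i.target := hx ▸ i.map_source (hsource _)
    refine ⟨hxt, Subtype.ext ?_⟩
    rw [coe_connectedSumGluing i (TwistedSphere.secondDisc f) hxt]
    have hw : i.toPartialDiffeomorph.symm (x : M) = ‖v‖ • (f (direction v) : Euc (m + 1)) := by
      rw [hx]
      exact i.left_inv (hsource _)
    have h0 : i.toPartialDiffeomorph.symm (x : M) ≠ 0 := by
      intro h
      rw [← hw, h] at hx
      exact mem_puncture.1 x.2 hx
    exact ((hcollar _ h0).2 hw).symm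

theorem mem_range_firstDisc_or_inl (q : ConnectedSum i (TwistedSphere.secondDisc f)) :
    q ∈ range (firstDiscDiffeo f i) ∨ q ∈ range (Glue.inl (connectedSumGluing i _)) := by
  rcases Glue.exists_rep _ q with h | ⟨s, rfl⟩
  · exact .inr h
  · obtain ⟨v, hv⟩ := mem_range_inl_of_mem_puncture f s.2
    exact .inl ⟨v, (firstDiscDiffeo_apply f i v).trans (congrArg (Glue.inr _) (Subtype.ext hv))⟩

theorem continuous_radialExtension :
    Continuous fun v : Euc (m + 1) => ‖v‖ • (f (direction v) : Euc (m + 1)) := by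
  refine continuous_iff_continuousAt.2 fun v => ?_
  rcases eq_or_ne v 0 with rfl | hv
  · rw [ContinuousAt, norm_zero, zero_smul, tendsto_zero_iff_norm_tendsto_zero]
    simpa [norm_smul] using (continuous_norm (E := Euc (m + 1))).tendsto 0
  · have h1 : ContinuousAt (direction (m := m)) v :=
      (contMDiffOn_direction.contMDiffAt (isOpen_compl_singleton.mem_nhds hv)).continuousAt
    exact continuous_norm.continuousAt.smul
      ((continuous_subtype_val.comp f.continuous).continuousAt.comp h1)

theorem t2Space_connectedSum [T2Space M] :
    T2Space (ConnectedSum i (TwistedSphere.secondDisc f)) := by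
  refine t2Space_of_isOpenEmbedding_cover
    (PartialDiffeomorph.isOpenEmbedding_of_source_univ (firstDiscDiffeo_source f i))
    (Glue.isOpenEmbedding_inl _) (mem_range_firstDisc_or_inl f i) ?_
  simp only [firstDiscDiffeo_eq_inl]
  exact isClosed_eq (continuous_subtype_val.comp continuous_snd)
    ((PartialDiffeomorph.contMDiff_of_source_univ i.source_eq_univ).continuous.comp
      ((continuous_radialExtension f).comp continuous_fst))

theorem secondCountable_connectedSum [SecondCountableTopology M] :
    SecondCountableTopology (ConnectedSum i (TwistedSphere.secondDisc f)) :=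
  secondCountable_of_isOpenEmbedding_cover
    (PartialDiffeomorph.isOpenEmbedding_of_source_univ (firstDiscDiffeo_source f i))
    (Glue.isOpenEmbedding_inl _) (mem_range_firstDisc_or_inl f i)

end ConnectedSumTwisted

/-- The radial extension of the adjoint map `φ̂` is `v ↦ ρ(φ(v/|v|)) v`. -/
theorem norm_smul_adjointDiffeo {m k : ℕ} {G : Type v} [Group G] [TopologicalSpace G]
    [ChartedSpace (Euc k) G] [LieGroup (𝓡 k) ∞ G] (ρ : G →* (Euc (m + 1) ≃ₗᵢ[ℝ] Euc (m + 1)))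
    (hρ : ContMDiff ((𝓡 k).prod (𝓡 (m + 1))) (𝓡 (m + 1)) ∞
      fun z : G × Euc (m + 1) => ρ z.1 z.2)
    (φ : UnitSphere m → G) (hφ : ContMDiff (𝓡 m) (𝓡 k) ∞ φ)
    (hconj : ∀ (g : G) (x : UnitSphere m), φ (sphereIsometry (ρ g) x) = g * φ x * g⁻¹)
    (v : Euc (m + 1)) :
    ‖v‖ • (adjointDiffeo ρ hρ φ hφ hconj (direction v) : Euc (m + 1)) =
      ρ (φ (direction v)) v := by
  change ‖v‖ • ρ (φ (direction v)) (direction v : Euc (m + 1)) = _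
  rcases eq_or_ne v 0 with rfl | hv
  · simp
  · rw [← map_smul, coe_direction hv, smul_smul, mul_inv_cancel₀ (norm_ne_zero_iff.2 hv), one_smul]

theorem mainTheorem5 {m k : ℕ}
    -- a compact Lie group `G`
    {G : Type v} [Group G] [TopologicalSpace G] [T2Space G] [CompactSpace G]
    [ChartedSpace (Euc k) G] [LieGroup (𝓡 k) ∞ G]
    -- a smooth `G`-manifold `M` of dimension `n = m + 1`
    {M : Type u} [TopologicalSpace M] [T2Space M] [SecondCountableTopology M]
    [ChartedSpace (Euc (m + 1)) M] [IsManifold (𝓡 (m + 1)) ∞ M]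
    [MulAction G M] [ContMDiffSMul (𝓡 k) (𝓡 (m + 1)) ∞ G M]
    -- a fixed point `p`, whose isotropy representation is `ρ` in the frame `L` of `T_p M`
    (p : M) (hp : ∀ g : G, g • p = p)
    (ρ : G →* (Euc (m + 1) ≃ₗᵢ[ℝ] Euc (m + 1)))
    (hρ : ContMDiff ((𝓡 k).prod (𝓡 (m + 1))) (𝓡 (m + 1)) ∞
      fun z : G × Euc (m + 1) => ρ z.1 z.2)
    (L : Euc (m + 1) ≃L[ℝ] TangentSpace (𝓡 (m + 1)) p)
    (hL : ∀ (g : G) (v : Euc (m + 1)),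
      mfderiv (𝓡 (m + 1)) (𝓡 (m + 1)) (fun x : M => g • x) p (L v) = L (ρ g v))
    -- a smooth map `φ : S^(n-1) → G` with `φ (ρ(g) x) = g φ(x) g⁻¹`
    (φ : UnitSphere m → G) (hφ : ContMDiff (𝓡 m) (𝓡 k) ∞ φ)
    (hconj : ∀ (g : G) (x : UnitSphere m), φ (sphereIsometry (ρ g) x) = g * φ x * g⁻¹)
    -- a smooth disc around `p`, tangent to the frame `L`, along which the connected sum is formed
    (i : SmoothDisc (m + 1) M) (hi : i.toPartialDiffeomorph 0 = p)
    (hdi : ∀ v : Euc (m + 1),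
      mfderiv (𝓡 (m + 1)) (𝓡 (m + 1)) i.toPartialDiffeomorph (0 : Euc (m + 1)) v = L v) :
    T2Space (ConnectedSum i (TwistedSphere.secondDisc (adjointDiffeo ρ hρ φ hφ hconj))) ∧
    SecondCountableTopology
      (ConnectedSum i (TwistedSphere.secondDisc (adjointDiffeo ρ hρ φ hφ hconj))) ∧
    ∃ (P : Type (max u v)) (_ : TopologicalSpace P)
      (_ : ChartedSpace (ModelProd (Euc (m + 1)) (Euc k)) P) (_ : MulAction (G × G) P)
      (π : P → M)
      (π' : P → ConnectedSum i (TwistedSphere.secondDisc (adjointDiffeo ρ hρ φ hφ hconj))),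
      T2Space P ∧ SecondCountableTopology P ∧
      IsManifold ((𝓡 (m + 1)).prod (𝓡 k)) ∞ P ∧ IsGGBundle (m + 1) k G π π' := by
  subst hi
  have : SecondCountableTopology G := ChartedSpace.secondCountable_of_sigmaCompact (Euc k) G
  refine ⟨t2Space_connectedSum _ i, secondCountable_connectedSum _ i, ?_⟩
  set f := adjointDiffeo ρ hρ φ hφ hconj
  have hi := i.source_eq_univ
  obtain ⟨Ψ, hΨ₀, ε, hε, hΨ⟩ := exists_diffeomorph_equivariant_near (i := i.toPartialDiffeomorph)
    hi hp ρ hρ fun g v => by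
      rw [hdi, hdi]
      exact hL g v
  have hΨ₀' : Ψ.symm (i.toPartialDiffeomorph 0) = i.toPartialDiffeomorph 0 := by
    rw [← hΨ₀, Ψ.symm_apply_apply, hΨ₀]
  let κ := radialShrink (m + 1) hε
  have hκ : κ.source = univ := radialShrink_source hε
  have hκ₀ : κ 0 = 0 := OpenPartialHomeomorph.univBall_apply_zero _ _
  -- The equivariant disc `Ψ⁻¹ ∘ i ∘ κ`.
  let e := (κ.trans i.toPartialDiffeomorph).trans Ψ.symm.toPartialDiffeomorph
  have he : e.source = univ :=
    eq_univ_of_forall fun v => ⟨⟨by simp [hκ], by simp [hi]⟩, mem_univ _⟩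
  have he_apply : ∀ v, e v = Ψ.symm (i.toPartialDiffeomorph (κ v)) := fun _ => rfl
  -- The two pieces of the connected sum, with the first one moved by `Ψ`.
  let a := κ.trans (firstDiscDiffeo f i)
  have ha : a.source = univ :=
    eq_univ_of_forall fun v => ⟨by simp [hκ], by simp [firstDiscDiffeo_source]⟩
  have hΨU : ∀ x : i.puncture, Ψ (x : M) ∈ i.puncture := fun x => mem_puncture.2 fun h =>
    mem_puncture.1 x.2 (Ψ.injective (h.trans hΨ₀.symm))
  let b := ((inclusionDiffeo i.puncture).trans (Ψ.toPartialDiffeomorph.trans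
    (inclusionDiffeo i.puncture).symm)).trans
      (Glue.inlDiffeo (connectedSumGluing i (TwistedSphere.secondDisc f)))
  have hb : b.source = univ := by
    refine eq_univ_of_forall fun x => ⟨⟨mem_univ _, mem_univ _, ?_⟩, mem_univ _⟩
    change _ ∈ (inclusionDiffeo (m := m) i.puncture).target
    rw [inclusionDiffeo_target]
    exact hΨU x
  have hb_apply : ∀ x, b x = Glue.inl _ ⟨Ψ (x : M), hΨU x⟩ := fun x =>
    congrArg (Glue.inl _) (Subtype.ext (coe_inclusionDiffeo_symm (m := m) _ (hΨU x)))
  refine exists_isGGBundle_of_equivariantDisc (p := i.toPartialDiffeomorph 0) hp ρ hρ hφ hconj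
    (U := i.puncture) (fun x => mem_puncture) he ?_ ?_ ha hb ?_ ?_
  · rw [he_apply, hκ₀, hΨ₀']
  · intro g v
    rw [he_apply, he_apply, hΨ _ (norm_radialShrink_lt hε v), radialShrink_map hε]
  · -- Away from its centre, the first disc of `Σ` lies in the image of `M \ {p}`.
    intro q
    rw [PartialDiffeomorph.target_eq_range ha, PartialDiffeomorph.target_eq_range hb]
    have hinl : ∀ x, Glue.inl (connectedSumGluing i (TwistedSphere.secondDisc f)) x ∈ range b := by
      intro x
      have hx : Ψ.symm (x : M) ∈ i.puncture := mem_puncture.2 fun h =>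
        mem_puncture.1 x.2 (Ψ.symm.injective (h.trans hΨ₀'.symm))
      exact ⟨⟨_, hx⟩, (hb_apply _).trans
        (congrArg (Glue.inl _) (Subtype.ext (Ψ.apply_symm_apply (x : M))))⟩
    rcases mem_range_firstDisc_or_inl f i q with ⟨w, rfl⟩ | ⟨x, rfl⟩
    · rcases eq_or_ne w 0 with rfl | hw
      · exact .inl ⟨0, congrArg (firstDiscDiffeo f i) hκ₀⟩
      · have hx : i.toPartialDiffeomorph (‖w‖ • (f (direction w) : Euc (m + 1))) ∈ i.puncture :=
          mem_puncture.2 fun h => smul_ne_zero (norm_ne_zero_iff.2 hw)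
            (ne_zero_of_mem_unit_sphere (f (direction w)))
            (i.injOn (by simp [hi]) (by simp [hi]) h)
        rw [(firstDiscDiffeo_eq_inl f i (x := ⟨_, hx⟩)).2 rfl]
        exact .inr (hinl _)
    · exact .inr (hinl x)
  · intro v x
    change firstDiscDiffeo f i (κ v) = b x ↔ _
    rw [hb_apply, firstDiscDiffeo_eq_inl, norm_smul_adjointDiffeo, direction_radialShrink hε,
      he_apply, radialShrink_map hε]
    exact ⟨fun h => by rw [← h, Ψ.symm_apply_apply], fun h =>
      (congrArg Ψ h).trans (Ψ.apply_symm_apply _)⟩
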